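/- Let $M$ be a connected, closed (compact, without boundary), smooth Riemannian manifold of dimension $n$, let $T\in(0,\infty]$, and let $H=H(x,p,u)$ be a real function of $(x,p)\in T^*M$ and $u\in\mathbb R$ such that: (H1) $H$ is continuous on $T^*M\times\mathbb R$; (H2) for every $R>0$ there is $K>0$ such that $H(x,p,u)>R$ whenever $|u|\le R$ and $|p|\ge K$, where $|p|$ is the norm on $T^*_xM$ dual to the Riemannian norm on $T_xM$; (H3) for every $(x,u)\in M\times\mathbb R$ the function $p\mapsto H(x,p,u)$ is convex on $T^*_xM$; (H4) there is $\Lambda>0$ such that $|H(x,p,u)-H(x,p,v)|\le\Lambda|u-v|$ for all $(x,p)\in T^*M$ and $u,v\in\mathbb R$. A function $u:M\times[0,T)\to\mathbb R$, continuous on $M\times(0,T)$, is called a viscosity solution of the Cauchy problem $$u_t+H(x,D_xu,u)=0\ \text{ in } M\times(0,T),\qquad u(x,0)=\phi(x)\ \text{ for } x\in M, \tag{CP}$$ if $u(\cdot,0)=\phi$ on $M$ and, for every $\psi\in C^1(M\times(0,T),\mathbb R)$ and every $(x,t)\in M\times(0,T)$: if $u-\psi$ attains its maximum over $M\times(0,T)$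 at $(x,t)$, then $\psi_t(x,t)+H(x,D_x\psi(x,t),u(x,t))\le0$; and if $u-\psi$ attains its minimum over $M\times(0,T)$ at $(x,t)$, then $\psi_t(x,t)+H(x,D_x\psi(x,t),u(x,t))\ge0$. **Theorem.** For every $\phi\in C^1(M,\mathbb R)$ there is exactly one viscosity solution $u$ of (CP) on $M\times[0,T)$ that is Lipschitz continuous on $M\times[0,T)$ if $T<\infty$, respectively Lipschitz continuous on $M\times[0,S)$ for every $0<S<\infty$ if $T=\infty$. -/

import Mathlib

open Set Bundle
open scoped Manifold ContDiff Bundle NNReal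

namespace ContactHJ

/-- The Euclidean model space `ℝⁿ` of the manifold. -/
abbrev Model (n : ℕ) : Type := EuclideanSpace ℝ (Fin n)

section Manifold

variable {n : ℕ} {M : Type*} [TopologicalSpace M] [ChartedSpace (Model n) M]

/-- The cotangent space `T*ₓM`, the (continuous) dual of the tangent space at `x`. When the tangent
bundle carries a Riemannian metric, its norm is the dual (operator) norm. -/
abbrev CotangentSpace (n : ℕ) {M : Type*} [TopologicalSpace M] [ChartedSpace (Model n) M]
    (x : M) : Type :=
  TangentSpace (𝓡 n) x →L[ℝ] ℝ

/-- A (not yet continuous) Hamiltonian `H(x,p,u)`, with `x ∈ M`, `p ∈ T*ₓM`, `u ∈ ℝ`. -/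
abbrev Hamiltonian (n : ℕ) (M : Type*) [TopologicalSpace M] [ChartedSpace (Model n) M] :
    Type _ :=
  (x : M) → CotangentSpace n x → ℝ → ℝ

/-- The total space `T*M` of the cotangent bundle, that is, of the vector bundle of continuous
linear maps from the tangent bundle to the trivial line bundle, with its vector bundle topology. -/
abbrev CotangentBundle (n : ℕ) (M : Type*) [TopologicalSpace M] [ChartedSpace (Model n) M]
    [IsManifold (𝓡 n) 1 M] : Type _ :=
  TotalSpace (Model n →L[ℝ] ℝ)
    (fun x : M => TangentSpace (𝓡 n) x →L[ℝ] Trivial M ℝ x)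

/-- (H1): `H` is continuous on `T*M × ℝ`. -/
def JointlyContinuous [IsManifold (𝓡 n) 1 M] (H : Hamiltonian n M) : Prop :=
  Continuous fun q : CotangentBundle n M × ℝ => H q.1.proj q.1.snd q.2

/-- (H2): for any `R > 0` there is `K > 0` such that `H(x,p,u) > R` if `|u| ≤ R` and
`|p| ≥ K`. -/
def Coercive [RiemannianBundle (fun x : M => TangentSpace (𝓡 n) x)]
    (H : Hamiltonian n M) : Prop :=
  ∀ R : ℝ, 0 < R → ∃ K : ℝ, 0 < K ∧
    ∀ (x : M) (p : CotangentSpace n x) (u : ℝ), |u| ≤ R → K ≤ ‖p‖ → R < H x p u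

/-- (H3): for any `(x,u)` the function `p ↦ H(x,p,u)` is convex on `T*ₓM`. -/
def ConvexInMomentum (H : Hamiltonian n M) : Prop :=
  ∀ (x : M) (u : ℝ), ConvexOn ℝ univ fun p : CotangentSpace n x => H x p u

/-- (H4): the functions `u ↦ H(x,p,u)`, with `(x,p) ∈ T*M`, are equi-Lipschitz continuous. -/
def EquiLipschitz (H : Hamiltonian n M) : Prop :=
  ∃ Λ : ℝ, 0 < Λ ∧ ∀ (x : M) (p : CotangentSpace n x) (u v : ℝ),
    |H x p u - H x p v| ≤ Λ * |u - v|

/-- The open space-time cylinder `M × (0,T)`, where `T ∈ (0,∞]`. -/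
def openCylinder (M : Type*) (T : EReal) : Set (M × ℝ) :=
  {z | 0 < z.2 ∧ (z.2 : EReal) < T}

/-- The half-open space-time cylinder `M × [0,T)`, where `T ∈ (0,∞]`. -/
def cylinder (M : Type*) (T : EReal) : Set (M × ℝ) :=
  {z | 0 ≤ z.2 ∧ (z.2 : EReal) < T}

/-- `ψ` is a `C¹` function on `M × (0,T)`. -/
def IsTestFunction (n : ℕ) {M : Type*} [TopologicalSpace M] [ChartedSpace (Model n) M]
    (T : EReal) (ψ : M × ℝ → ℝ) : Prop :=
  ContMDiffOn ((𝓡 n).prod 𝓘(ℝ, ℝ)) 𝓘(ℝ, ℝ) 1 ψ (openCylinder M T)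

/-- The expression `ψ_t(x,t) + H(x, D_xψ(x,t), r)`. -/
noncomputable def hjExpr (H : Hamiltonian n M) (ψ : M × ℝ → ℝ) (x : M) (t r : ℝ) : ℝ :=
  deriv (fun s => ψ (x, s)) t + H x (mvfderiv (𝓡 n) (fun y => ψ (y, t)) x) r

/-- `u` is a (Crandall-Lions) viscosity subsolution of `u_t + H(x, D_xu, u) = 0` in
`M × (0,T)`. -/
def IsViscositySubsolution (H : Hamiltonian n M) (T : EReal) (u : M × ℝ → ℝ) : Prop :=
  UpperSemicontinuousOn u (openCylinder M T) ∧
    ∀ ψ : M × ℝ → ℝ, IsTestFunction n T ψ → ∀ (x : M) (t : ℝ), (x, t) ∈ openCylinder M T →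
      IsMaxOn (fun z => u z - ψ z) (openCylinder M T) (x, t) →
        hjExpr H ψ x t (u (x, t)) ≤ 0

/-- `u` is a (Crandall-Lions) viscosity supersolution of `u_t + H(x, D_xu, u) = 0` in
`M × (0,T)`. -/
def IsViscositySupersolution (H : Hamiltonian n M) (T : EReal) (u : M × ℝ → ℝ) : Prop :=
  LowerSemicontinuousOn u (openCylinder M T) ∧
    ∀ ψ : M × ℝ → ℝ, IsTestFunction n T ψ → ∀ (x : M) (t : ℝ), (x, t) ∈ openCylinder M T →
      IsMinOn (fun z => u z - ψ z) (openCylinder M T) (x, t) →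
        0 ≤ hjExpr H ψ x t (u (x, t))

/-- `u` is a viscosity solution of the Cauchy problem `u_t + H(x, D_xu, u) = 0` in `M × (0,T)`,
`u(·,0) = φ` on `M`. Only the values of `u` on `M × [0,T)` matter. -/
def IsCauchySolution (H : Hamiltonian n M) (T : EReal) (φ : M → ℝ) (u : M × ℝ → ℝ) : Prop :=
  IsViscositySubsolution H T u ∧ IsViscositySupersolution H T u ∧ ∀ x : M, u (x, 0) = φ x

end Manifold

/-- `u` is Lipschitz continuous on `M × [0,S)` for every finite `S ≤ T`. If `T < ∞`, this says
exactly that `u` is Lipschitz continuous on `M × [0,T)`. -/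
def IsLipschitzOnCylinder {M : Type*} [PseudoEMetricSpace M] (T : EReal) (u : M × ℝ → ℝ) : Prop :=
  ∀ S : ℝ, (S : EReal) ≤ T → ∃ K : ℝ≥0, LipschitzOnWith K u (cylinder M (S : EReal))

end ContactHJ

open ContactHJ

namespace ContactHJ

open Filter Topology

/-! ### The equation in local coordinates -/

section TimeDerivative

variable {n : ℕ} {M : Type*} [TopologicalSpace M] [ChartedSpace (Model n) M]

/-! Existence is Perron's method, arranged so that regularity of the supremum needs no comparison
principle. Let `L` be the Lipschitz constant of `H` in `u`, let `C` bound `|H(x, Dφ, φ)|`, and let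
`f` solve `f' = C + L f`, `f 0 = 0`. Then `φ - f` and `φ + f` are a classical subsolution and
supersolution. Let `u` be the supremum of all upper semicontinuous subsolutions below `φ + f`.
Translating a subsolution in time and subtracting `κ e^{Lt}` with `κ ≥ 0` gives a subsolution again
(`SubsolutionAt.shift`). For the right `κ` the translate is still a competitor, after gluing with
the lower barrier when the translation delays it, so `u` is locally Lipschitz in time
(`BarrierData.abs_perronSup_sub_le`). The upper envelope of `u` is a competitor too, hence equals
`u`, which is therefore a subsolution. Test functions touching `u` from above now have time
derivative bounded below, so coercivity bounds their gradients, and comparison with cones in a chart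
makes `u` Lipschitz in space (`exists_abs_sub_le_mul_dist`). Since `u` is continuous, a failure of
the supersolution property would allow a bump to be added inside the family, against maximality
(`exists_larger_subsolution`).

Uniqueness is a doubling of variables in a chart (`deriv_le_of_sub_super`). The time-Lipschitz bound
and coercivity confine the momenta on the subsolution side to a compact set. In the limit both
Hamiltonians are evaluated at the same point and covector, so continuity of `H` suffices and only
the difference in the variable `u` survives. A weight in time absorbs that difference
(`le_of_sub_super`). -/

/-- The derivative in time of a function that is `g` in the chart centred at `c`. -/
theorem deriv_eq_of_chart (c x : M) (t : ℝ) (ψ : M × ℝ → ℝ) (g : Model n × ℝ → ℝ)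
    (hg : DifferentiableAt ℝ g (extChartAt (𝓡 n) c x, t))
    (hψ : ψ =ᶠ[𝓝 (x, t)] fun z => g (extChartAt (𝓡 n) c z.1, z.2)) :
    deriv (fun s => ψ (x, s)) t = fderiv ℝ g (extChartAt (𝓡 n) c x, t) (0, 1) := by
  have h2 : (fun s => ψ (x, s)) =ᶠ[𝓝 t] fun s => g (extChartAt (𝓡 n) c x, s) := by
    have : Tendsto (fun s : ℝ => (x, s)) (𝓝 t) (𝓝 (x, t)) := by
      apply Continuous.tendsto; fun_prop
    exact this.eventually hψ
  rw [h2.deriv_eq]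
  have h3 : HasDerivAt (fun s : ℝ => (extChartAt (𝓡 n) c x, s)) ((0 : Model n), (1 : ℝ)) t :=
    (hasDerivAt_const _ _).prodMk (hasDerivAt_id t)
  exact (hg.hasFDerivAt.comp_hasDerivAt t h3).deriv

end TimeDerivative

section Chart

variable {n : ℕ} {M : Type*} [TopologicalSpace M] [ChartedSpace (Model n) M]
  [IsManifold (𝓡 n) 1 M]

/-- The derivative at `x` of the chart centred at `c`, as the trivialization of the tangent
bundle. -/
noncomputable def chartDeriv (c x : M) : TangentSpace (𝓡 n) x →L[ℝ] Model n :=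
  (trivializationAt (Model n) (TangentSpace (𝓡 n)) c).continuousLinearMapAt ℝ x

/-- The covector at `x` with coordinates `p` in the chart centred at `c`. -/
noncomputable def chartCovector (c x : M) (p : Model n →L[ℝ] ℝ) : CotangentSpace n x :=
  p.comp (chartDeriv c x)

/-- The map is the inverse of the trivialization of the cotangent bundle centred at `c`. This turns
continuity on `T*M` into continuity in the coordinates of covectors. -/
theorem continuousOn_chartCovector (c : M) :
    ContinuousOn (fun q : M × (Model n →L[ℝ] ℝ) =>
      (⟨q.1, chartCovector c q.1 q.2⟩ : CotangentBundle n M))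
      ((chartAt (Model n) c).source ×ˢ univ) := by
  set e := trivializationAt (Model n →L[ℝ] ℝ)
    (fun x : M => TangentSpace (𝓡 n) x →L[ℝ] Trivial M ℝ x) c with he
  have hbase : e.baseSet = (chartAt (Model n) c).source := by
    rw [he, hom_trivializationAt_baseSet]
    simp
  have h := e.continuousOn_invFun
  rw [e.target_eq, hbase] at h
  refine h.congr ?_
  rintro ⟨x, p⟩ ⟨hx, -⟩
  simp only at hx
  have hx' : x ∈ e.baseSet := by rwa [hbase]
  have hxs : (⟨x, chartCovector c x p⟩ : CotangentBundle n M) ∈ e.source :=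
    e.mem_source.2 hx'
  have hx2 : x ∈ (trivializationAt (Model n) (TangentSpace (𝓡 n)) c).baseSet := by simpa using hx
  have key : e ⟨x, chartCovector c x p⟩ = (x, p) := by
    rw [he, hom_trivializationAt_apply]
    refine Prod.ext rfl ?_
    ext v
    rw [ContinuousLinearMap.inCoordinates_eq hx2 (by simp)]
    simp only [chartCovector, chartDeriv]
    have h5 := ((trivializationAt (Model n) (TangentSpace (𝓡 n)) c).continuousLinearEquivAt ℝ x
      hx2).apply_symm_apply v
    rw [Trivialization.coe_continuousLinearEquivAt_eq] at h5
    exact congrArg p h5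
  have h3 := e.left_inv hxs
  exact h3.symm.trans (congrArg e.toOpenPartialHomeomorph.symm key)

theorem continuousOn_hamiltonian_chartCovector {H : Hamiltonian n M} (hH : JointlyContinuous H)
    (c : M) :
    ContinuousOn (fun q : M × (Model n →L[ℝ] ℝ) × ℝ => H q.1 (chartCovector c q.1 q.2.1) q.2.2)
      ((chartAt (Model n) c).source ×ˢ univ) := by
  have h1 : ContinuousOn (fun q : M × (Model n →L[ℝ] ℝ) × ℝ =>
      ((⟨q.1, chartCovector c q.1 q.2.1⟩ : CotangentBundle n M), q.2.2))
      ((chartAt (Model n) c).source ×ˢ univ) := by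
    refine ContinuousOn.prodMk ?_ (by fun_prop)
    exact (continuousOn_chartCovector c).comp (t := (chartAt (Model n) c).source ×ˢ univ)
      (f := fun q : M × (Model n →L[ℝ] ℝ) × ℝ => (q.1, q.2.1)) (by fun_prop)
      (fun q hq => ⟨hq.1, mem_univ _⟩)
  exact hH.comp_continuousOn h1

/-- The differential in space of a function that is `g` in the chart centred at `c`. -/
theorem mvfderiv_eq_of_chart (c x : M) (t : ℝ) (ψ : M × ℝ → ℝ)
    (g : Model n × ℝ → ℝ) (hx : x ∈ (chartAt (Model n) c).source)
    (hg : DifferentiableAt ℝ g (extChartAt (𝓡 n) c x, t))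
    (hψ : ψ =ᶠ[𝓝 (x, t)] fun z => g (extChartAt (𝓡 n) c z.1, z.2)) :
    mvfderiv (𝓡 n) (fun y => ψ (y, t)) x = chartCovector c x
        ((fderiv ℝ g (extChartAt (𝓡 n) c x, t)).comp
          (ContinuousLinearMap.inl ℝ (Model n) ℝ)) := by
  have h2 : (fun y => ψ (y, t)) =ᶠ[𝓝 x]
      (fun ξ => g (ξ, t)) ∘ extChartAt (𝓡 n) c := by
    have : Tendsto (fun y : M => (y, t)) (𝓝 x) (𝓝 (x, t)) := by
      apply Continuous.tendsto; fun_prop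
    exact this.eventually hψ
  have h5 : HasFDerivAt (fun ξ => g (ξ, t)) ((fderiv ℝ g (extChartAt (𝓡 n) c x, t)).comp
      (ContinuousLinearMap.inl ℝ (Model n) ℝ)) (extChartAt (𝓡 n) c x) :=
    hg.hasFDerivAt.comp (f := fun ξ => (ξ, t)) _ (hasFDerivAt_prodMk_left _ _)
  have h6 : HasMFDerivAt (𝓡 n) 𝓘(ℝ, ℝ) ((fun ξ => g (ξ, t)) ∘ extChartAt (𝓡 n) c) x
      (chartCovector c x ((fderiv ℝ g (extChartAt (𝓡 n) c x, t)).comp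
        (ContinuousLinearMap.inl ℝ (Model n) ℝ))) := by
    have := (mdifferentiableAt_extChartAt (I := 𝓡 n) hx).hasMFDerivAt
    have h7 := h5.hasMFDerivAt.comp x this
    rw [← TangentBundle.continuousLinearMapAt_trivializationAt hx] at h7
    exact h7
  have h8 := (h6.congr_of_eventuallyEq h2).mfderiv
  rw [mvfderiv, h8]
  rfl

/-- The expression `ψ_t + H(x, D_xψ, r)` of a function that is `g` in the chart centred at `c`. -/
theorem hjExpr_eq_of_chart (H : Hamiltonian n M) (c x : M) (t r : ℝ) (ψ : M × ℝ → ℝ)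
    (g : Model n × ℝ → ℝ) (hx : x ∈ (chartAt (Model n) c).source)
    (hg : DifferentiableAt ℝ g (extChartAt (𝓡 n) c x, t))
    (hψ : ψ =ᶠ[𝓝 (x, t)] fun z => g (extChartAt (𝓡 n) c z.1, z.2)) :
    hjExpr H ψ x t r = fderiv ℝ g (extChartAt (𝓡 n) c x, t) (0, 1) +
      H x (chartCovector c x
        ((fderiv ℝ g (extChartAt (𝓡 n) c x, t)).comp (ContinuousLinearMap.inl ℝ (Model n) ℝ))) r := by
  rw [hjExpr, deriv_eq_of_chart c x t ψ g hg hψ, mvfderiv_eq_of_chart c x t ψ g hx hg hψ]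

theorem contDiffAt_comp_chart_symm {c x : M} {t : ℝ} {ψ : M × ℝ → ℝ}
    (hx : x ∈ (chartAt (Model n) c).source)
    (hψ : ContMDiffAt ((𝓡 n).prod 𝓘(ℝ, ℝ)) 𝓘(ℝ, ℝ) 1 ψ (x, t)) :
    ContDiffAt ℝ 1 (fun z : Model n × ℝ => ψ ((extChartAt (𝓡 n) c).symm z.1, z.2))
      (extChartAt (𝓡 n) c x, t) := by
  have hx' : x ∈ (extChartAt (𝓡 n) c).source := by simpa using hx
  have h1 : ContMDiffAt 𝓘(ℝ, Model n) (𝓡 n) 1 (extChartAt (𝓡 n) c).symm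
      (extChartAt (𝓡 n) c x) := by
    have := contMDiffOn_extChartAt_symm (I := 𝓡 n) (n := 1) c
    exact this.contMDiffAt (by
      exact (isOpen_extChartAt_target c).mem_nhds ((extChartAt (𝓡 n) c).map_source hx'))
  have h2 : ContMDiffAt 𝓘(ℝ, Model n × ℝ) ((𝓡 n).prod 𝓘(ℝ, ℝ)) 1
      (fun z : Model n × ℝ => ((extChartAt (𝓡 n) c).symm z.1, z.2))
      (extChartAt (𝓡 n) c x, t) :=
    ContMDiffAt.prodMk (h1.comp (extChartAt (𝓡 n) c x, t) contDiffAt_fst.contMDiffAt)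
      contDiffAt_snd.contMDiffAt
  have h3 : ((extChartAt (𝓡 n) c).symm (extChartAt (𝓡 n) c x), t) = (x, t) := by
    rw [(extChartAt (𝓡 n) c).left_inv hx']
  have h4 := ContMDiffAt.comp_of_eq (g := ψ) hψ h2 h3
  exact h4.contDiffAt

theorem contMDiffAt_comp_chart {c x : M} {t : ℝ} {g : Model n × ℝ → ℝ}
    (hx : x ∈ (chartAt (Model n) c).source)
    (hg : ContDiffAt ℝ 1 g (extChartAt (𝓡 n) c x, t)) :
    ContMDiffAt ((𝓡 n).prod 𝓘(ℝ, ℝ)) 𝓘(ℝ, ℝ) 1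
      (fun z : M × ℝ => g (extChartAt (𝓡 n) c z.1, z.2)) (x, t) := by
  have h1 : ContMDiffAt (𝓡 n) 𝓘(ℝ, Model n) 1 (extChartAt (𝓡 n) c) x :=
    contMDiffAt_extChartAt' hx
  have h2 : ContMDiffAt ((𝓡 n).prod 𝓘(ℝ, ℝ)) 𝓘(ℝ, Model n × ℝ) 1
      (fun z : M × ℝ => (extChartAt (𝓡 n) c z.1, z.2)) (x, t) :=
    ContMDiffAt.prodMk_space (h1.comp (x, t) contMDiffAt_fst) contMDiffAt_snd
  exact hg.contMDiffAt.comp (x, t) h2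

theorem hjExpr_eq_pullback (H : Hamiltonian n M) (c x : M) (t r : ℝ) (ψ : M × ℝ → ℝ)
    (hx : x ∈ (chartAt (Model n) c).source)
    (hψ : ContMDiffAt ((𝓡 n).prod 𝓘(ℝ, ℝ)) 𝓘(ℝ, ℝ) 1 ψ (x, t)) :
    hjExpr H ψ x t r =
      fderiv ℝ (fun z : Model n × ℝ => ψ ((extChartAt (𝓡 n) c).symm z.1, z.2))
        (extChartAt (𝓡 n) c x, t) (0, 1) +
      H x (chartCovector c x
        ((fderiv ℝ (fun z : Model n × ℝ => ψ ((extChartAt (𝓡 n) c).symm z.1, z.2))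
          (extChartAt (𝓡 n) c x, t)).comp (ContinuousLinearMap.inl ℝ (Model n) ℝ))) r := by
  refine hjExpr_eq_of_chart H c x t r ψ _ hx
    ((contDiffAt_comp_chart_symm hx hψ).differentiableAt one_ne_zero) ?_
  have h : ∀ᶠ z : M × ℝ in 𝓝 (x, t), z.1 ∈ (extChartAt (𝓡 n) c).source :=
    continuous_fst.continuousAt.eventually
      ((isOpen_extChartAt_source c).mem_nhds (by simpa using hx))
  filter_upwards [h] with z hz
  rw [(extChartAt (𝓡 n) c).left_inv hz]

/-- A strict inequality for `hjExpr` at a point thus persists for nearby points and nearby values of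
`r`, which both perturbation arguments below rely on. -/
theorem continuousAt_hjExpr {H : Hamiltonian n M} (hH : JointlyContinuous H) {ψ : M × ℝ → ℝ}
    {z : M × ℝ} (hψ : ContMDiffAt ((𝓡 n).prod 𝓘(ℝ, ℝ)) 𝓘(ℝ, ℝ) 1 ψ z) (r : ℝ) :
    ContinuousAt (fun q : (M × ℝ) × ℝ => hjExpr H ψ q.1.1 q.1.2 q.2) (z, r) := by
  obtain ⟨x, t⟩ := z
  set c := x
  set e := extChartAt (𝓡 n) c
  have hx : x ∈ (chartAt (Model n) c).source := mem_chart_source _ _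
  set g : Model n × ℝ → ℝ := fun z => ψ (e.symm z.1, z.2)
  have hg : ContDiffAt ℝ 1 g (e x, t) := contDiffAt_comp_chart_symm hx hψ
  have hg' : ContinuousAt (fderiv ℝ g) (e x, t) :=
    (hg.fderiv_right (m := 0) (by simp)).continuousAt
  have he : ContinuousAt (fun q : (M × ℝ) × ℝ => (e q.1.1, q.1.2)) ((x, t), r) := by
    refine ContinuousAt.prodMk ?_ (by fun_prop)
    exact (continuousAt_extChartAt' (I := 𝓡 n) (by simpa using hx)).comp
      (f := fun q : (M × ℝ) × ℝ => q.1.1) (by fun_prop)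
  have hd : ContinuousAt (fun q : (M × ℝ) × ℝ => fderiv ℝ g (e q.1.1, q.1.2)) ((x, t), r) :=
    ContinuousAt.comp (f := fun q : (M × ℝ) × ℝ => (e q.1.1, q.1.2)) hg' he
  have hHc : ContinuousAt (fun q : M × (Model n →L[ℝ] ℝ) × ℝ =>
      H q.1 (chartCovector c q.1 q.2.1) q.2.2)
      (x, (fderiv ℝ g (e x, t)).comp (ContinuousLinearMap.inl ℝ (Model n) ℝ), r) :=
    (continuousOn_hamiltonian_chartCovector hH c).continuousAt
      (((chartAt (Model n) c).open_source.prod isOpen_univ).mem_nhds ⟨hx, mem_univ _⟩)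
  have h2 : ContinuousAt (fun q : (M × ℝ) × ℝ => (q.1.1,
      (fderiv ℝ g (e q.1.1, q.1.2)).comp (ContinuousLinearMap.inl ℝ (Model n) ℝ), q.2))
      ((x, t), r) := by
    refine ContinuousAt.prodMk (by fun_prop) (ContinuousAt.prodMk ?_ (by fun_prop))
    exact hd.clm_comp continuousAt_const
  have h3 := (hd.clm_apply (continuousAt_const (y := ((0 : Model n), (1 : ℝ))))).add
    (ContinuousAt.comp (x := ((x, t), r)) (f := fun q : (M × ℝ) × ℝ => (q.1.1,
      (fderiv ℝ g (e q.1.1, q.1.2)).comp (ContinuousLinearMap.inl ℝ (Model n) ℝ), q.2)) hHc h2)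
  refine h3.congr ?_
  have hev : ∀ᶠ q : (M × ℝ) × ℝ in 𝓝 ((x, t), r), q.1.1 ∈ (chartAt (Model n) c).source ∧
      ContMDiffAt ((𝓡 n).prod 𝓘(ℝ, ℝ)) 𝓘(ℝ, ℝ) 1 ψ q.1 := by
    refine Filter.Eventually.and ?_ ?_
    · exact (by fun_prop : ContinuousAt (fun q : (M × ℝ) × ℝ => q.1.1) ((x, t), r)).eventually
        ((chartAt (Model n) c).open_source.mem_nhds hx)
    · exact (continuousAt_fst (p := ((x, t), r))).eventually ((contMDiffAt_iff_contMDiffAt_nhds (by simp)).1 hψ)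
  filter_upwards [hev] with q hq
  exact (hjExpr_eq_pullback H c q.1.1 q.1.2 q.2 ψ hq.1 hq.2).symm

/-- At a local extremum of `g - ψ` the space-time differentials coincide, and `hjExpr` sees a
function only through its differential. -/
theorem hjExpr_eq_of_isLocalMax_sub (H : Hamiltonian n M) {ψ g : M × ℝ → ℝ} {z : M × ℝ}
    (hψ : ContMDiffAt ((𝓡 n).prod 𝓘(ℝ, ℝ)) 𝓘(ℝ, ℝ) 1 ψ z)
    (hg : ContMDiffAt ((𝓡 n).prod 𝓘(ℝ, ℝ)) 𝓘(ℝ, ℝ) 1 g z)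
    (h : IsLocalMax (fun y => g y - ψ y) z) (r : ℝ) :
    hjExpr H ψ z.1 z.2 r = hjExpr H g z.1 z.2 r := by
  obtain ⟨x, t⟩ := z
  have hx : x ∈ (chartAt (Model n) x).source := mem_chart_source _ _
  have hψ' := contDiffAt_comp_chart_symm hx hψ
  have hg' := contDiffAt_comp_chart_symm hx hg
  have key : fderiv ℝ (fun z : Model n × ℝ => ψ ((extChartAt (𝓡 n) x).symm z.1, z.2))
        (extChartAt (𝓡 n) x x, t) = fderiv ℝ
        (fun z : Model n × ℝ => g ((extChartAt (𝓡 n) x).symm z.1, z.2))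
        (extChartAt (𝓡 n) x x, t) := by
    have hmax : IsLocalMax ((fun z : Model n × ℝ => g ((extChartAt (𝓡 n) x).symm z.1, z.2)) -
        fun z : Model n × ℝ => ψ ((extChartAt (𝓡 n) x).symm z.1, z.2))
        (extChartAt (𝓡 n) x x, t) := by
      have hc : Tendsto (fun z : Model n × ℝ => ((extChartAt (𝓡 n) x).symm z.1, z.2))
          (𝓝 (extChartAt (𝓡 n) x x, t)) (𝓝 (x, t)) := by
        have h1 : ContinuousAt (fun z : Model n × ℝ => ((extChartAt (𝓡 n) x).symm z.1, z.2))
          (extChartAt (𝓡 n) x x, t) := by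
          refine ContinuousAt.prodMk ?_ (by fun_prop)
          exact (continuousAt_extChartAt_symm (I := 𝓡 n) x).comp
            (f := fun z : Model n × ℝ => z.1) (x := (extChartAt (𝓡 n) x x, t)) (by fun_prop)
        have h2 := h1.tendsto
        simpa only [extChartAt_to_inv] using h2
      have := hc.eventually h
      refine this.mono fun y hy => ?_
      simpa only [Pi.sub_apply, extChartAt_to_inv] using hy
    have h0 := hmax.fderiv_eq_zero
    rw [fderiv_sub (hg'.differentiableAt one_ne_zero) (hψ'.differentiableAt one_ne_zero)] at h0
    exact (sub_eq_zero.1 h0).symm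
  rw [hjExpr_eq_pullback H x x t r ψ hx hψ, hjExpr_eq_pullback H x x t r g hx hg, key]

end Chart

/-! ### Pointwise viscosity tests with local test functions -/

section Pointwise

variable {n : ℕ} {M : Type*} [TopologicalSpace M] [ChartedSpace (Model n) M]

/-- `ψ` is of class `C¹` around the point `z` of space-time. -/
def IsC1At (n : ℕ) {M : Type*} [TopologicalSpace M] [ChartedSpace (Model n) M]
    (ψ : M × ℝ → ℝ) (z : M × ℝ) : Prop :=
  ContMDiffAt ((𝓡 n).prod 𝓘(ℝ, ℝ)) 𝓘(ℝ, ℝ) 1 ψ z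

/-- The viscosity subsolution test at one point, with local test functions. -/
def SubsolutionAt (H : Hamiltonian n M) (w : M × ℝ → ℝ) (z : M × ℝ) : Prop :=
  ∀ ψ : M × ℝ → ℝ, IsC1At n ψ z → IsLocalMax (fun y => w y - ψ y) z →
    hjExpr H ψ z.1 z.2 (w z) ≤ 0

/-- The viscosity supersolution test at one point, with local test functions. -/
def SupersolutionAt (H : Hamiltonian n M) (w : M × ℝ → ℝ) (z : M × ℝ) : Prop :=
  ∀ ψ : M × ℝ → ℝ, IsC1At n ψ z → IsLocalMin (fun y => w y - ψ y) z →
    0 ≤ hjExpr H ψ z.1 z.2 (w z)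

theorem IsC1At.add {ψ g : M × ℝ → ℝ} {z : M × ℝ} (hψ : IsC1At n ψ z) (hg : IsC1At n g z) :
    IsC1At n (fun y => ψ y + g y) z :=
  ContMDiffAt.add hψ hg

theorem IsC1At.sub {ψ g : M × ℝ → ℝ} {z : M × ℝ} (hψ : IsC1At n ψ z) (hg : IsC1At n g z) :
    IsC1At n (fun y => ψ y - g y) z :=
  ContMDiffAt.sub hψ hg

theorem isC1At_const (a : ℝ) (z : M × ℝ) : IsC1At n (fun _ => a) z :=
  contMDiffAt_const

theorem isC1At_time {f : ℝ → ℝ} {z : M × ℝ} (hf : ContDiffAt ℝ 1 f z.2) :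
    IsC1At n (fun y : M × ℝ => f y.2) z :=
  hf.contMDiffAt.comp z contMDiffAt_snd

theorem isC1At_space {φ : M → ℝ} (hφ : ContMDiff (𝓡 n) 𝓘(ℝ, ℝ) 1 φ) (z : M × ℝ) :
    IsC1At n (fun y : M × ℝ => φ y.1) z :=
  (hφ z.1).comp z contMDiffAt_fst

theorem IsC1At.continuousAt {ψ : M × ℝ → ℝ} {z : M × ℝ} (hψ : IsC1At n ψ z) :
    ContinuousAt ψ z :=
  ContMDiffAt.continuousAt hψ

theorem IsC1At.comp_shift {ψ : M × ℝ → ℝ} {x : M} {t h : ℝ} (hψ : IsC1At n ψ (x, t)) :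
    IsC1At n (fun y : M × ℝ => ψ (y.1, y.2 - h)) (x, t + h) := by
  have h1 : ContMDiffAt ((𝓡 n).prod 𝓘(ℝ, ℝ)) ((𝓡 n).prod 𝓘(ℝ, ℝ)) 1
      (fun y : M × ℝ => (y.1, y.2 - h)) (x, t + h) :=
    contMDiffAt_fst.prodMk (contMDiffAt_snd.sub contMDiffAt_const)
  exact ContMDiffAt.comp_of_eq (g := ψ) hψ h1 (by simp)

theorem hjExpr_congr (H : Hamiltonian n M) {ψ g : M × ℝ → ℝ} {z : M × ℝ}
    (h : ψ =ᶠ[𝓝 z] g) (r : ℝ) : hjExpr H ψ z.1 z.2 r = hjExpr H g z.1 z.2 r := by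
  obtain ⟨x, t⟩ := z
  have h1 : (fun s => ψ (x, s)) =ᶠ[𝓝 t] fun s => g (x, s) :=
    (by fun_prop : Continuous fun s : ℝ => (x, s)).continuousAt.eventually h
  have h2 : (fun y => ψ (y, t)) =ᶠ[𝓝 x] fun y => g (y, t) :=
    (by fun_prop : Continuous fun y : M => (y, t)).continuousAt.eventually h
  simp only [hjExpr, h1.deriv_eq, mvfderiv, h2.mfderiv_eq]
  rw [h2.eq_of_nhds]
  rfl

theorem IsC1At.differentiableAt_time {ψ : M × ℝ → ℝ} {x : M} {t : ℝ} (hψ : IsC1At n ψ (x, t)) :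
    DifferentiableAt ℝ (fun s => ψ (x, s)) t := by
  have h2 : ContMDiffAt 𝓘(ℝ, ℝ) 𝓘(ℝ, ℝ) 1 (fun s => ψ (x, s)) t :=
    ContMDiffAt.comp (g := ψ) t hψ (contMDiffAt_const.prodMk contMDiffAt_id)
  exact h2.contDiffAt.differentiableAt one_ne_zero

theorem hjExpr_add_time (H : Hamiltonian n M) {ψ : M × ℝ → ℝ} {f : ℝ → ℝ} {x : M} {t : ℝ}
    (hψ : IsC1At n ψ (x, t)) (hf : DifferentiableAt ℝ f t) (r : ℝ) :
    hjExpr H (fun y => ψ y + f y.2) x t r = hjExpr H ψ x t r + deriv f t := by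
  have h1 := hψ.differentiableAt_time
  have h3 : MDifferentiableAt (𝓡 n) 𝓘(ℝ, ℝ) (fun y => ψ (y, t)) x :=
    (ContMDiffAt.comp (g := ψ) (f := fun y : M => (y, t)) x hψ
      (contMDiffAt_id.prodMk contMDiffAt_const)).mdifferentiableAt
      one_ne_zero
  have h4 : mvfderiv (𝓡 n) (fun y => ψ (y, t) + f t) x =
      mvfderiv (𝓡 n) (fun y => ψ (y, t)) x := by
    have := mvfderiv_fun_add h3 (mdifferentiableAt_const (c := f t))
    rw [this, mvfderiv_const, add_zero]
  simp only [hjExpr]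
  rw [deriv_fun_add h1 hf, h4]
  ring

theorem hjExpr_add_const (H : Hamiltonian n M) {ψ : M × ℝ → ℝ} {x : M} {t : ℝ}
    (hψ : IsC1At n ψ (x, t)) (a r : ℝ) :
    hjExpr H (fun y => ψ y + a) x t r = hjExpr H ψ x t r := by
  have := hjExpr_add_time H hψ (differentiableAt_const a) r
  simpa using this

theorem hjExpr_shift (H : Hamiltonian n M) (ψ : M × ℝ → ℝ) (x : M) (t h r : ℝ) :
    hjExpr H (fun y => ψ (y.1, y.2 - h)) x (t + h) r = hjExpr H ψ x t r := by
  simp only [hjExpr]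
  rw [deriv_comp_sub_const (f := fun s => ψ (x, s))]
  simp

/-- Whatever touches `v` from above at `z` also touches the smaller function `w` there. Applied to
each branch, this handles maxima of subsolutions. -/
theorem SubsolutionAt.of_le {H : Hamiltonian n M} {w v : M × ℝ → ℝ} {z : M × ℝ}
    (hw : SubsolutionAt H w z) (hle : ∀ᶠ y in 𝓝 z, w y ≤ v y) (heq : w z = v z) :
    SubsolutionAt H v z := by
  intro ψ hψ hmax
  rw [← heq]
  refine hw ψ hψ ?_
  filter_upwards [hle, hmax] with y h1 h2
  linarith

theorem SupersolutionAt.of_ge {H : Hamiltonian n M} {w v : M × ℝ → ℝ} {z : M × ℝ}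
    (hw : SupersolutionAt H w z) (hle : ∀ᶠ y in 𝓝 z, v y ≤ w y) (heq : w z = v z) :
    SupersolutionAt H v z := by
  intro ψ hψ hmax
  rw [← heq]
  refine hw ψ hψ ?_
  filter_upwards [hle, hmax] with y h1 h2
  linarith

theorem subsolutionAt_of_hjExpr_nonpos [IsManifold (𝓡 n) 1 M] {H : Hamiltonian n M}
    {g : M × ℝ → ℝ} {z : M × ℝ}
    (hg : IsC1At n g z) (h : hjExpr H g z.1 z.2 (g z) ≤ 0) : SubsolutionAt H g z := by
  intro ψ hψ hmax
  rwa [hjExpr_eq_of_isLocalMax_sub H hψ hg hmax]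

theorem supersolutionAt_of_hjExpr_nonneg [IsManifold (𝓡 n) 1 M] {H : Hamiltonian n M}
    {g : M × ℝ → ℝ} {z : M × ℝ}
    (hg : IsC1At n g z) (h : 0 ≤ hjExpr H g z.1 z.2 (g z)) : SupersolutionAt H g z := by
  intro ψ hψ hmin
  rwa [← hjExpr_eq_of_isLocalMax_sub H hg hψ]
  filter_upwards [hmin] with y hy
  linarith

/-- Lowering the value by `κ e^{Lt}` raises `H` by at most `L κ e^{Lt}`, which is exactly the amount
by which it lowers the time derivative. -/
theorem SubsolutionAt.shift {H : Hamiltonian n M} {L : ℝ}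
    (hL : ∀ (x : M) (p : CotangentSpace n x) (u v : ℝ), |H x p u - H x p v| ≤ L * |u - v|)
    {w : M × ℝ → ℝ} {x : M} {t h κ : ℝ} (hκ : 0 ≤ κ) (hw : SubsolutionAt H w (x, t + h)) :
    SubsolutionAt H (fun y => w (y.1, y.2 + h) - κ * Real.exp (L * y.2)) (x, t) := by
  intro ψ hψ hmax
  have hf : ContDiff ℝ 1 (fun s : ℝ => κ * Real.exp (L * s)) := by fun_prop
  have hd : deriv (fun s : ℝ => κ * Real.exp (L * s)) t = L * (κ * Real.exp (L * t)) := by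
    have h1 : HasDerivAt (fun s : ℝ => L * s) L t := by
      simpa using (hasDerivAt_id t).const_mul L
    rw [(h1.exp.const_mul κ).deriv]
    ring
  set g : M × ℝ → ℝ := fun y => ψ y + κ * Real.exp (L * y.2) with hg
  have hgC : IsC1At n g (x, t) := hψ.add (isC1At_time (z := (x, t)) hf.contDiffAt)
  have h1 := hw _ (hgC.comp_shift (h := h)) (by
    have hc : Tendsto (fun y : M × ℝ => (y.1, y.2 - h)) (𝓝 (x, t + h)) (𝓝 (x, t)) := by
      have : Continuous (fun y : M × ℝ => (y.1, y.2 - h)) := by fun_prop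
      have h2 := this.tendsto (x, t + h)
      simpa using h2
    have := hc.eventually hmax
    filter_upwards [this] with y hy
    simp only [sub_add_cancel, hg, add_sub_cancel_right] at hy ⊢
    linarith)
  simp only at h1
  rw [hjExpr_shift, hg, hjExpr_add_time H hψ (hf.differentiable one_ne_zero t), hd] at h1
  have h3 := hL x (mvfderiv (𝓡 n) (fun y => ψ (y, t)) x)
    (w (x, t + h) - κ * Real.exp (L * t)) (w (x, t + h))
  have h4 : |w (x, t + h) - κ * Real.exp (L * t) - w (x, t + h)| = κ * Real.exp (L * t) := by
    rw [show w (x, t + h) - κ * Real.exp (L * t) - w (x, t + h) = -(κ * Real.exp (L * t)) by ring,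
      abs_neg, abs_of_nonneg (by positivity)]
  rw [h4] at h3
  have h5 := (abs_le.1 h3).2
  simp only [hjExpr] at h1 ⊢
  linarith

theorem isOpen_openCylinder (T : EReal) : IsOpen (openCylinder M T) := by
  have h : Continuous fun z : M × ℝ => (z.2 : EReal) :=
    continuous_coe_real_ereal.comp continuous_snd
  exact (isOpen_lt continuous_const continuous_snd).inter (isOpen_lt h continuous_const)

/-- Near any time, the times before `T` are the times before some real number. -/
theorem eventually_lt_real_of_lt {T : EReal} (hT : 0 < T) (s : ℝ) :
    ∃ S : ℝ, (S : EReal) ≤ T ∧ ∀ᶠ r : ℝ in 𝓝 s, (r : EReal) < T → r < S := by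
  induction T with
  | bot => simp at hT
  | coe T => exact ⟨T, le_rfl, Eventually.of_forall fun r hr => EReal.coe_lt_coe_iff.1 hr⟩
  | top =>
    refine ⟨s + 1, le_top, ?_⟩
    filter_upwards [eventually_lt_nhds (show s < s + 1 by linarith)] with r hr _
    exact hr

theorem IsViscositySubsolution.of_subsolutionAt {H : Hamiltonian n M} {T : EReal}
    {u : M × ℝ → ℝ} (hu : ContinuousOn u (openCylinder M T))
    (h : ∀ z ∈ openCylinder M T, SubsolutionAt H u z) : IsViscositySubsolution H T u := by
  refine ⟨hu.upperSemicontinuousOn, fun ψ hψ x t hz hmax => h _ hz ψ ?_ ?_⟩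
  · exact hψ.contMDiffAt ((isOpen_openCylinder T).mem_nhds hz)
  · exact hmax.isLocalMax ((isOpen_openCylinder T).mem_nhds hz)

theorem IsViscositySupersolution.of_supersolutionAt {H : Hamiltonian n M} {T : EReal}
    {u : M × ℝ → ℝ} (hu : ContinuousOn u (openCylinder M T))
    (h : ∀ z ∈ openCylinder M T, SupersolutionAt H u z) : IsViscositySupersolution H T u := by
  refine ⟨hu.lowerSemicontinuousOn, fun ψ hψ x t hz hmax => h _ hz ψ ?_ ?_⟩
  · exact hψ.contMDiffAt ((isOpen_openCylinder T).mem_nhds hz)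
  · exact hmax.isLocalMin ((isOpen_openCylinder T).mem_nhds hz)

/-- A local test function at a local maximum extends to a global one at a global maximum. -/
theorem exists_isTestFunction_of_isLocalMax [CompactSpace M] [T2Space M]
    [IsManifold (𝓡 n) ∞ M] {T : EReal} (hT : 0 < T) {v ψ : M × ℝ → ℝ} {z : M × ℝ}
    (hv : ∀ S : ℝ, (S : EReal) ≤ T → BddAbove (v '' cylinder M (S : EReal)))
    (hψ : IsC1At n ψ z) (hmax : IsLocalMax (fun y => v y - ψ y) z) :
    ∃ Ψ : M × ℝ → ℝ, IsTestFunction n T Ψ ∧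
      IsMaxOn (fun y => v y - Ψ y) (openCylinder M T) z ∧
      Ψ =ᶠ[𝓝 z] fun y => ψ y + (v z - ψ z) := by
  set g : M × ℝ → ℝ := fun y => ψ y + (v z - ψ z) with hg
  have hN : {y | ContMDiffAt ((𝓡 n).prod 𝓘(ℝ, ℝ)) 𝓘(ℝ, ℝ) 1 ψ y ∧
      v y - ψ y ≤ v z - ψ z} ∈ 𝓝 z :=
    ((contMDiffAt_iff_contMDiffAt_nhds (by simp)).1 hψ).and hmax
  obtain ⟨V, hVz, hVc, hVN⟩ := exists_mem_nhds_isClosed_subset (interior_mem_nhds.2 hN)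
  -- The requirements "`Ψ ≥ v` on the cylinder" and "`Ψ = g` on `V`" are convex at each point, so
  -- local solutions glue by a partition of unity: `g` itself near `V`, and away from `V` a constant
  -- bounding `v` up to a slightly later time.
  obtain ⟨Ψ, hΨ⟩ := exists_contMDiffMap_forall_mem_convex_of_local
    (n := 1) (I := (𝓡 n).prod 𝓘(ℝ, ℝ)) (M := M × ℝ) (F := ℝ)
    (t := fun y => {a : ℝ | (y ∈ openCylinder M T → v y ≤ a) ∧ (y ∈ V → a = g y)})
    (fun y => by
      by_cases hy : y ∈ V <;> by_cases hy' : y ∈ openCylinder M T <;> simp [hy, hy']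
      · have : {a : ℝ | v y ≤ a ∧ a = g y} = Ici (v y) ∩ {g y} := rfl
        rw [this]
        exact (convex_Ici _).inter (convex_singleton _)
      · exact convex_Ici _
      · exact convex_univ)
    (fun y => by
      by_cases hy : y ∈ V
      · refine ⟨_, isOpen_interior.mem_nhds (hVN hy), g, ?_, ?_⟩
        · intro a ha
          have := (interior_subset ha).1
          exact (this.add contMDiffAt_const).contMDiffWithinAt
        · intro a ha
          have h2 := (interior_subset ha).2
          exact ⟨fun _ => by simp only [hg]; linarith, fun _ => rfl⟩
      · obtain ⟨S, hS, hS'⟩ := eventually_lt_real_of_lt hT y.2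
        obtain ⟨B, hB⟩ := hv S hS
        refine ⟨_, inter_mem (hVc.isOpen_compl.mem_nhds hy)
          (continuous_snd.continuousAt.eventually hS'), fun _ => B, contMDiffOn_const, ?_⟩
        rintro a ⟨ha, ha'⟩
        refine ⟨fun h => hB ⟨a, ⟨h.1.le, ?_⟩, rfl⟩, fun h => absurd h ha⟩
        exact EReal.coe_lt_coe_iff.2 (ha' h.2))
  have hzV : z ∈ V := mem_of_mem_nhds hVz
  refine ⟨Ψ, Ψ.contMDiff.contMDiffOn, ?_, ?_⟩
  · intro y hy
    have h1 := (hΨ y).1 hy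
    have h2 := (hΨ z).2 hzV
    simp only [hg] at h2
    simp only [mem_ofPred_eq, h2]
    linarith
  · filter_upwards [hVz] with y hy
    exact (hΨ y).2 hy

/-- Uniqueness starts from solutions known only through global tests, while the comparison argument
builds its tests in a chart. The bounds on `v` allow a local test to be extended. -/
theorem IsViscositySubsolution.subsolutionAt [CompactSpace M] [T2Space M]
    [IsManifold (𝓡 n) ∞ M] {H : Hamiltonian n M} {T : EReal} (hT : 0 < T) {v : M × ℝ → ℝ}
    (hv : ∀ S : ℝ, (S : EReal) ≤ T → BddAbove (v '' cylinder M (S : EReal)))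
    (h : IsViscositySubsolution H T v) {z : M × ℝ} (hz : z ∈ openCylinder M T) :
    SubsolutionAt H v z := by
  intro ψ hψ hmax
  obtain ⟨Ψ, h1, h2, h3⟩ := exists_isTestFunction_of_isLocalMax hT hv hψ hmax
  have h4 := h.2 Ψ h1 z.1 z.2 hz h2
  rwa [hjExpr_congr H h3, hjExpr_add_const H hψ] at h4

theorem IsViscositySupersolution.supersolutionAt [CompactSpace M] [T2Space M]
    [IsManifold (𝓡 n) ∞ M] {H : Hamiltonian n M} {T : EReal} (hT : 0 < T) {v : M × ℝ → ℝ}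
    (hv : ∀ S : ℝ, (S : EReal) ≤ T → BddBelow (v '' cylinder M (S : EReal)))
    (h : IsViscositySupersolution H T v) {z : M × ℝ} (hz : z ∈ openCylinder M T) :
    SupersolutionAt H v z := by
  intro ψ hψ hmin
  have hψ' : IsC1At n (fun y => -ψ y) z := ContMDiffAt.neg hψ
  obtain ⟨Ψ, h1, h2, h3⟩ := exists_isTestFunction_of_isLocalMax (v := fun y => -v y) hT
    (fun S hS => by
      obtain ⟨B, hB⟩ := hv S hS
      refine ⟨-B, ?_⟩
      rintro _ ⟨y, hy, rfl⟩
      exact neg_le_neg (hB ⟨y, hy, rfl⟩)) hψ' (by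
      filter_upwards [hmin] with y hy
      linarith)
  have h5 : (fun y => -Ψ y) =ᶠ[𝓝 z] fun y => ψ y + (v z - ψ z) := by
    filter_upwards [h3] with y hy
    rw [hy]
    ring
  have h4 := h.2 (fun y => -Ψ y) (ContMDiffOn.neg h1) z.1 z.2 hz (by
    intro y hy
    have := h2 hy
    simp only [mem_ofPred_eq] at this ⊢
    linarith)
  rwa [hjExpr_congr H h5, hjExpr_add_const H hψ] at h4

end Pointwise

/-! ### Riemannian distance and dual norm in coordinates -/

section ChartLipschitz

open MeasureTheory Manifold
open scoped ENNReal

variable {E : Type*} [NormedAddCommGroup E] [NormedSpace ℝ E] {G : Type*} [TopologicalSpace G]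
  (I : ModelWithCorners ℝ E G) {M : Type*} [MetricSpace M] [ChartedSpace G M]
  [RiemannianBundle (fun x : M => TangentSpace I x)] [IsManifold I 1 M]
  [IsContinuousRiemannianBundle E (fun x : M => TangentSpace I x)] [IsRiemannianManifold I M]

attribute [local instance] normedAddCommGroupTangentSpaceVectorSpace
attribute [local instance] normedSpaceTangentSpaceVectorSpace

/-- Charts are locally Lipschitz for the Riemannian distance. -/
theorem exists_dist_extChartAt_le (c : M) :
    ∃ C : ℝ, 0 < C ∧ ∃ δ > 0, ∀ x ∈ Metric.ball c δ, ∀ y ∈ Metric.ball c δ,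
      dist (extChartAt I c x) (extChartAt I c y) ≤ C * dist x y := by
  obtain ⟨C, C_pos, hC⟩ := eventually_norm_mfderiv_extChartAt_lt I c
  obtain ⟨ε, hε, hball⟩ := Metric.eventually_nhds_iff_ball.1
    (hC.and (chart_source_mem_nhds G c))
  lift C to ℝ≥0 using C_pos.le
  refine ⟨C, C_pos, ε / 3, by positivity, fun x hx y hy => ?_⟩
  have hxy : dist x y < 2 * (ε / 3) := by
    have := dist_triangle_right x y c
    rw [Metric.mem_ball] at hx hy
    linarith
  -- A curve from `x` to `y` of length below `r` stays within `ε / 3 + r < ε` of `c`, where the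
  -- differential of the chart is bounded by `C`; integrate along it.
  have key : ∀ r : ℝ, dist x y < r → r < 2 * (ε / 3) →
      dist (extChartAt I c x) (extChartAt I c y) ≤ C * r := by
    intro r hr1 hr2
    have hr0 : 0 < r := dist_nonneg.trans_lt hr1
    have hlt : riemannianEDist I x y < ENNReal.ofReal r := by
      rw [← IsRiemannianManifold.out (I := I), edist_dist]
      exact (ENNReal.ofReal_lt_ofReal_iff hr0).2 hr1
    obtain ⟨γ, hγx, hγy, γ_smooth, hγ, -⟩ :=
      exists_lt_locally_constant_of_riemannianEDist_lt hlt zero_lt_one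
    have hmem : ∀ t ∈ Icc (0 : ℝ) 1, γ t ∈ Metric.ball c ε := by
      intro t ht
      have h1 : edist x (γ t) < ENNReal.ofReal r := by
        rw [IsRiemannianManifold.out (I := I)]
        refine (riemannianEDist_le_pathELength (γ := γ) γ_smooth.contMDiffOn hγx rfl ht.1).trans_lt
          (lt_of_le_of_lt ?_ hγ)
        exact pathELength_mono le_rfl ht.2
      rw [edist_dist, ENNReal.ofReal_lt_ofReal_iff hr0] at h1
      rw [Metric.mem_ball] at hx ⊢
      have := dist_triangle_left (γ t) c x
      linarith
    let γ' := extChartAt I c ∘ γ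
    have hC1 : CMDiff[Icc 0 1] 1 γ' :=
      contMDiffOn_extChartAt.comp (I' := I) (t := (chartAt G c).source)
        γ_smooth.contMDiffOn (fun t' ht' => (hball _ (hmem t' ht')).2)
    have h2 : ‖γ' 1 - γ' 0‖ₑ ≤ C * ENNReal.ofReal r := by
      calc
        ‖γ' 1 - γ' 0‖ₑ
      _ ≤ ∫⁻ t' in Icc (0 : ℝ) 1, ‖derivWithin γ' (Icc 0 1) t'‖ₑ := by
        apply enorm_sub_le_lintegral_derivWithin_Icc_of_contDiffOn_Icc _ zero_le_one
        rwa [← contMDiffOn_iff_contDiffOn]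
      _ = ∫⁻ t' in Icc (0 : ℝ) 1, ‖mfderiv[Icc 0 1] γ' t' 1‖ₑ := by
        simp_rw [← fderivWithin_derivWithin, mfderivWithin_eq_fderivWithin]
        rfl
      _ ≤ ∫⁻ t' in Icc (0 : ℝ) 1, C * ‖mfderiv[Icc (0 : ℝ) 1] γ t' 1‖ₑ := by
        apply setLIntegral_mono' measurableSet_Icc (fun t' ht' ↦ ?_)
        have : mfderiv[Icc 0 1] γ' t' =
            (mfderiv% (extChartAt I c) (γ t')) ∘L (mfderiv[Icc 0 1] γ t') := by
          apply mfderiv_comp_mfderivWithin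
          · exact mdifferentiableAt_extChartAt (hball _ (hmem t' ht')).2
          · exact (γ_smooth.mdifferentiable one_ne_zero).mdifferentiableOn _ ht'
          · rw [uniqueMDiffWithinAt_iff_uniqueDiffWithinAt]
            exact uniqueDiffOn_Icc zero_lt_one _ ht'
        have : mfderiv[Icc 0 1] γ' t' 1 =
            (mfderiv% (extChartAt I c) (γ t')) (mfderiv[Icc 0 1] γ t' 1) :=
          congr($this 1)
        rw [this]
        apply (ContinuousLinearMap.le_opENorm _ _).trans
        gcongr
        have h3 := (hball _ (hmem t' ht')).1
        simp only [enorm, nnnorm]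
        exact_mod_cast h3.le
      _ = C * pathELength I γ 0 1 := by
        rw [lintegral_const_mul' _ _ ENNReal.coe_ne_top,
            pathELength_eq_lintegral_mfderivWithin_Icc]
      _ ≤ C * ENNReal.ofReal r := by
        gcongr
    have h3 : ENNReal.ofReal (dist (extChartAt I c x) (extChartAt I c y)) ≤
        ENNReal.ofReal (C * r) := by
      rw [← edist_dist, edist_comm, edist_eq_enorm_sub, ENNReal.ofReal_mul NNReal.zero_le_coe,
        ENNReal.ofReal_coe_nnreal]
      convert! h2
      · simp [γ', hγy]
      · simp [γ', hγx]
    exact (ENNReal.ofReal_le_ofReal_iff (by positivity)).1 h3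
  refine le_of_forall_gt_imp_ge_of_dense fun a ha => ?_
  -- An admissible `r` must lie above `dist x y`, below `2 * (ε / 3)` and at most `a / C`; hence the
  -- minimum with a midpoint.
  have hb : dist x y < a / C := by rwa [lt_div_iff₀' C_pos]
  have h4 := key (min (a / C) ((dist x y + 2 * (ε / 3)) / 2)) (lt_min hb (by linarith))
    ((min_le_right _ _).trans_lt (by linarith))
  refine h4.trans ?_
  calc (C : ℝ) * min (a / C) ((dist x y + 2 * (ε / 3)) / 2) ≤ C * (a / C) := by
        gcongr; exact min_le_left _ _
    _ = a := by field_simp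

end ChartLipschitz

section Riemannian

variable {n : ℕ} {M : Type*} [MetricSpace M] [ChartedSpace (Model n) M]
  [IsManifold (𝓡 n) 1 M] [RiemannianBundle (fun x : M => TangentSpace (𝓡 n) x)]
  [IsContinuousRiemannianBundle (Model n) (fun x : M => TangentSpace (𝓡 n) x)]

/-- Near the centre of a chart, coordinates of covectors are bounded by the dual norm. -/
theorem eventually_norm_le_norm_chartCovector (c : M) :
    ∃ C : ℝ, 0 < C ∧ ∀ᶠ x in 𝓝 c, ∀ p : Model n →L[ℝ] ℝ,
      ‖p‖ ≤ C * ‖(chartCovector c x p : CotangentSpace n x)‖ := by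
  obtain ⟨C, hC, h⟩ := eventually_norm_symmL_trivializationAt_lt (Model n)
    (fun x : M => TangentSpace (𝓡 n) x) c
  refine ⟨C, hC, ?_⟩
  filter_upwards [h, (trivializationAt (Model n) (TangentSpace (𝓡 n)) c).open_baseSet.mem_nhds
    (mem_baseSet_trivializationAt (Model n) (TangentSpace (𝓡 n)) c)] with x hx hxb p
  refine ContinuousLinearMap.opNorm_le_bound _ (by positivity) fun v => ?_
  have h1 : p v = chartCovector c x p
      ((trivializationAt (Model n) (TangentSpace (𝓡 n)) c).symmL ℝ x v) := by
    simp only [chartCovector, chartDeriv]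
    have := (trivializationAt (Model n) (TangentSpace (𝓡 n)) c).continuousLinearMapAt_symmL
      (R := ℝ) hxb v
    exact (congrArg p this).symm
  rw [h1]
  refine (ContinuousLinearMap.le_opNorm _ _).trans ?_
  have h2 := ContinuousLinearMap.le_of_opNorm_le _ hx.le v
  calc _ ≤ ‖chartCovector c x p‖ * (C * ‖v‖) := by gcongr
    _ = _ := by ring

end Riemannian

/-- On a compact space, a bounded family of functions that is locally equi-Lipschitz is
equi-Lipschitz. -/
theorem exists_forall_abs_sub_le_of_locally {M ι : Type*} [MetricSpace M] [CompactSpace M]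
    {f : ι → M → ℝ} {R : ℝ} (hR : ∀ i x, |f i x| ≤ R)
    (hloc : ∀ c : M, ∃ L : ℝ, ∃ U ∈ 𝓝 c, ∀ x ∈ U, ∀ y ∈ U, ∀ i,
      |f i x - f i y| ≤ L * dist x y) :
    ∃ K : ℝ, 0 ≤ K ∧ ∀ i x y, |f i x - f i y| ≤ K * dist x y := by
  have h : ∃ K : ℝ, 0 ≤ K ∧ ∀ q ∈ (univ : Set (M × M)), ∀ i,
      |f i q.1 - f i q.2| ≤ K * dist q.1 q.2 := by
    -- Compactness of `M × M`: near the diagonal the local estimate applies, and off it the distance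
    -- is bounded below while differences are at most `2 * |R|`.
    refine isCompact_univ.induction_on (p := fun s : Set (M × M) => ∃ K : ℝ, 0 ≤ K ∧
      ∀ q ∈ s, ∀ i, |f i q.1 - f i q.2| ≤ K * dist q.1 q.2) ⟨0, le_rfl, by simp⟩ ?_ ?_ ?_
    · rintro s t hst ⟨K, hK, h⟩
      exact ⟨K, hK, fun q hq => h q (hst hq)⟩
    · rintro s t ⟨K, hK, h⟩ ⟨K', hK', h'⟩
      refine ⟨max K K', le_max_of_le_left hK, fun q hq i => ?_⟩
      rcases hq with hq | hq
      · exact (h q hq i).trans (by gcongr; exact le_max_left _ _)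
      · exact (h' q hq i).trans (by gcongr; exact le_max_right _ _)
    · rintro ⟨a, b⟩ -
      simp only [nhdsWithin_univ]
      by_cases hab : a = b
      · subst hab
        obtain ⟨L, U, hU, h⟩ := hloc a
        refine ⟨U ×ˢ U, prod_mem_nhds hU hU, max L 0, le_max_right _ _, fun q hq i => ?_⟩
        exact (h _ hq.1 _ hq.2 i).trans (by gcongr; exact le_max_left _ _)
      · have hd : 0 < dist a b := dist_pos.2 hab
        refine ⟨{q | dist a b / 2 < dist q.1 q.2}, ?_, 2 * |R| / (dist a b / 2), by positivity, ?_⟩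
        · have : ContinuousAt (fun q : M × M => dist q.1 q.2) (a, b) := by fun_prop
          exact this.eventually (lt_mem_nhds (by simp only; linarith))
        · intro q hq i
          have h1 := abs_le.1 ((hR i q.1).trans (le_abs_self R))
          have h2 := abs_le.1 ((hR i q.2).trans (le_abs_self R))
          have h3 : |f i q.1 - f i q.2| ≤ 2 * |R| := by
            rw [abs_le]
            constructor <;> linarith [h1.1, h1.2, h2.1, h2.2]
          refine h3.trans ?_
          have h4 : dist a b / 2 ≤ dist q.1 q.2 := le_of_lt hq
          calc 2 * |R| = 2 * |R| / (dist a b / 2) * (dist a b / 2) := by field_simp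
            _ ≤ _ := by gcongr
  obtain ⟨K, hK, h⟩ := h
  exact ⟨K, hK, fun i x y => h (x, y) (mem_univ _) i⟩

/-! ### From a time bound and coercivity to a Lipschitz bound in space -/

section LocalTests

variable {n : ℕ} {M : Type*} [TopologicalSpace M] [ChartedSpace (Model n) M]

/-- For later times the increments of `ψ` dominate those of `w`; divide by `s - t` and let `s`
decrease to `t`. -/
theorem neg_le_deriv_of_isLocalMax {w ψ : M × ℝ → ℝ} {x : M} {t C : ℝ}
    (hψ : IsC1At n ψ (x, t)) (hmax : IsLocalMax (fun y => w y - ψ y) (x, t))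
    (hw : ∀ᶠ s in 𝓝 t, t < s → -C * (s - t) ≤ w (x, s) - w (x, t)) :
    -C ≤ deriv (fun s => ψ (x, s)) t := by
  have h1 := hψ.differentiableAt_time.hasDerivAt.hasDerivWithinAt (s := Ioi t)
  rw [hasDerivWithinAt_iff_tendsto_slope' (by simp)] at h1
  refine ge_of_tendsto h1 ?_
  have h2 : ∀ᶠ s in 𝓝 t, w (x, s) - ψ (x, s) ≤ w (x, t) - ψ (x, t) :=
    (by fun_prop : Continuous fun s : ℝ => (x, s)).continuousAt.eventually hmax
  filter_upwards [nhdsWithin_le_nhds h2, nhdsWithin_le_nhds hw, self_mem_nhdsWithin] with s h3 h4 h5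
  have h6 : 0 < s - t := sub_pos.2 h5
  rw [slope_def_field, le_div_iff₀ h6]
  linarith [h4 h5]

/-- Around `c`, closed balls in the chart at `c` on which an eventual property holds. -/
theorem exists_closedBall_extChartAt {c : M} {P : M → Prop} (hP : ∀ᶠ x in 𝓝 c, P x) :
    ∃ ρ > 0, Metric.closedBall (extChartAt (𝓡 n) c c) ρ ⊆ (extChartAt (𝓡 n) c).target ∧
      ∀ ξ ∈ Metric.closedBall (extChartAt (𝓡 n) c c) ρ, P ((extChartAt (𝓡 n) c).symm ξ) := by
  have h1 : (extChartAt (𝓡 n) c).target ∈ 𝓝 (extChartAt (𝓡 n) c c) :=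
    (isOpen_extChartAt_target c).mem_nhds (mem_extChartAt_target c)
  have h2 : ∀ᶠ ξ in 𝓝 (extChartAt (𝓡 n) c c), P ((extChartAt (𝓡 n) c).symm ξ) := by
    have := (continuousAt_extChartAt_symm (I := 𝓡 n) c).tendsto
    rw [extChartAt_to_inv] at this
    exact this.eventually hP
  obtain ⟨ρ, hρ, h⟩ := Metric.nhds_basis_closedBall.mem_iff.1 (inter_mem h1 h2)
  exact ⟨ρ, hρ, fun ξ hξ => (h hξ).1, fun ξ hξ => (h hξ).2⟩

theorem eventually_chart_of_eventually_model {c x : M} {t : ℝ}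
    (hx : x ∈ (chartAt (Model n) c).source) {P : Model n × ℝ → Prop}
    (hP : ∀ᶠ z in 𝓝 (extChartAt (𝓡 n) c x, t), P z) :
    ∀ᶠ z : M × ℝ in 𝓝 (x, t), P (extChartAt (𝓡 n) c z.1, z.2) := by
  have h : ContinuousAt (fun z : M × ℝ => (extChartAt (𝓡 n) c z.1, z.2)) (x, t) :=
    ((continuousAt_extChartAt' (I := 𝓡 n) (by simpa using hx)).comp
      (f := fun z : M × ℝ => z.1) (x := (x, t)) continuousAt_fst).prodMk continuousAt_snd
  exact h.eventually hP

end LocalTests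

section GradientBound

variable {n : ℕ} {M : Type*} [MetricSpace M] [ChartedSpace (Model n) M]
  [RiemannianBundle (fun x : M => TangentSpace (𝓡 n) x)]

/-- By coercivity, test functions of a subsolution with a lower bound on its time derivative have
bounded gradients. -/
theorem Coercive.exists_norm_mvfderiv_le {H : Hamiltonian n M} (hH : Coercive H) (R C : ℝ) :
    ∃ K : ℝ, 0 < K ∧ ∀ (w ψ : M × ℝ → ℝ) (x : M) (t : ℝ), SubsolutionAt H w (x, t) →
      |w (x, t)| ≤ R →
      (∀ᶠ s in 𝓝 t, t < s → -C * (s - t) ≤ w (x, s) - w (x, t)) →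
      IsC1At n ψ (x, t) → IsLocalMax (fun y => w y - ψ y) (x, t) →
      ‖(mvfderiv (𝓡 n) (fun y => ψ (y, t)) x : CotangentSpace n x)‖ ≤ K := by
  -- The level exceeds `R` so that coercivity applies at the value `w (x, t)`, and `C` so that a
  -- large gradient would give `H > C ≥ -ψ_t`.
  obtain ⟨K, hK, h⟩ := hH (max (max R C) 1) (by positivity)
  refine ⟨K, hK, fun w ψ x t hw hR hC hψ hmax => ?_⟩
  by_contra hlt
  have h1 := h x (mvfderiv (𝓡 n) (fun y => ψ (y, t)) x) (w (x, t))
    (hR.trans ((le_max_left _ _).trans (le_max_left _ _))) (not_le.1 hlt).le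
  have h2 := hw ψ hψ hmax
  have h3 := neg_le_deriv_of_isLocalMax hψ hmax hC
  have h4 : C ≤ max (max R C) 1 := (le_max_right _ _).trans (le_max_left _ _)
  simp only [hjExpr] at h2
  linarith

end GradientBound

section Lipschitz

variable {n : ℕ} {M : Type*} [MetricSpace M] [ChartedSpace (Model n) M]
  [IsManifold (𝓡 n) 1 M] [RiemannianBundle (fun x : M => TangentSpace (𝓡 n) x)]
  [IsContinuousRiemannianBundle (Model n) (fun x : M => TangentSpace (𝓡 n) x)]

/-- A time-Lipschitz subsolution of a coercive equation is Lipschitz in space, near any point and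
in coordinates. -/
theorem exists_sub_le_mul_dist_extChartAt {H : Hamiltonian n M} (hH : Coercive H)
    {w : M × ℝ → ℝ} {S R C : ℝ} (hsub : ∀ z : M × ℝ, 0 < z.2 → SubsolutionAt H w z)
    (husc : UpperSemicontinuousOn w {z | 0 < z.2})
    (hR : ∀ (x : M) (t : ℝ), 0 < t → t < S → |w (x, t)| ≤ R)
    (hC : ∀ (x : M) (s t : ℝ), 0 < s → s < S → 0 < t → t < S →
      |w (x, s) - w (x, t)| ≤ C * |s - t|) (c : M) :
    ∃ L : ℝ, ∃ U ∈ 𝓝 c, ∀ x ∈ U, ∀ y ∈ U, ∀ t : ℝ, 0 < t → t < S →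
      w (x, t) - w (y, t) ≤ L * dist (extChartAt (𝓡 n) c x) (extChartAt (𝓡 n) c y) := by
  obtain ⟨K, hK, hgrad⟩ := hH.exists_norm_mvfderiv_le R C
  obtain ⟨D, hD, hcov⟩ := eventually_norm_le_norm_chartCovector (n := n) c
  set e := extChartAt (𝓡 n) c with he
  obtain ⟨ρ', hρ', htar, hcov'⟩ := exists_closedBall_extChartAt (n := n) hcov
  rw [← he] at htar hcov'
  set ρ := ρ' / 3 with hρdef
  have hρ : 0 < ρ := by positivity
  -- The first entry makes the cone steeper than any admissible gradient in coordinates; the second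
  -- makes it outgrow the oscillation `2 * R` of `w` before the edge of the ball.
  set L := max (D * K + 1) ((2 * R + 1) / ρ) with hL
  have hL1 : D * K < L := lt_of_lt_of_le (by linarith) (le_max_left _ _)
  have hL0 : 0 < L := lt_trans (by positivity) hL1
  have hL2 : 2 * R + 1 ≤ L * ρ := by
    rw [← div_le_iff₀ hρ]; exact le_max_right _ _
  refine ⟨L, {x | x ∈ e.source ∧ dist (e x) (e c) < ρ}, ?_, ?_⟩
  · refine inter_mem (extChartAt_source_mem_nhds c) ?_
    exact (continuousAt_extChartAt (I := 𝓡 n) c).eventually (Metric.ball_mem_nhds _ hρ)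
  rintro x ⟨hxs, hx⟩ y ⟨hys, hy⟩ t ht0 htS
  set η := e y with hη
  have hball : Metric.closedBall η (2 * ρ) ⊆ Metric.closedBall (e c) ρ' := by
    intro ξ hξ
    rw [Metric.mem_closedBall] at hξ ⊢
    have := dist_triangle ξ η (e c)
    have h3 : ρ' = 3 * ρ := by rw [hρdef]; ring
    linarith
  obtain ⟨a, ha0, ha1, ha2⟩ : ∃ a > 0, a < t ∧ t + a < S := by
    refine ⟨min (t / 2) ((S - t) / 2), by
      have : 0 < S - t := by linarith
      positivity, ?_, ?_⟩
    · have := min_le_left (t / 2) ((S - t) / 2); linarith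
    · have := min_le_right (t / 2) ((S - t) / 2); linarith
  have hinv : ∀ z ∈ e.source, e.symm (e z) = z := fun z hz => e.left_inv hz
  -- Maximize `w` minus the cone of slope `L` with apex `η` and minus `κ (s - t)²`. The lower bound
  -- on `κ` keeps the maximum at interior times.
  have key : ∀ κ : ℝ, 0 < κ → 2 * R < κ * a ^ 2 →
      w (x, t) - w (y, t) ≤ L * dist (e x) η + C ^ 2 / κ := by
    intro κ hκ hκa
    set N : Set (Model n × ℝ) := Metric.closedBall η (2 * ρ) ×ˢ Icc (t - a) (t + a) with hN
    have hNc : IsCompact N := (isCompact_closedBall η (2 * ρ)).prod isCompact_Icc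
    set g : Model n × ℝ → ℝ := fun z => L * ‖z.1 - η‖ + κ * (z.2 - t) ^ 2 with hg
    have hηN : (η, t) ∈ N := ⟨Metric.mem_closedBall_self (by positivity), by constructor <;> linarith⟩
    have hxN : (e x, t) ∈ N := by
      refine ⟨?_, by constructor <;> simp only <;> linarith⟩
      rw [Metric.mem_closedBall]
      have := dist_triangle_right (e x) η (e c)
      simp only
      linarith
    have husc' : UpperSemicontinuousOn (fun z : Model n × ℝ => w (e.symm z.1, z.2) - g z) N := by
      have h1 : UpperSemicontinuousOn (fun z : Model n × ℝ => w (e.symm z.1, z.2)) N := by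
        refine husc.comp (f := w) (g := fun z : Model n × ℝ => (e.symm z.1, z.2)) ?_ ?_
        · refine ContinuousOn.prodMk ?_ (by fun_prop)
          exact (continuousOn_extChartAt_symm (I := 𝓡 n) c).comp (f := fun z : Model n × ℝ => z.1)
            (by fun_prop) fun z hz => htar (hball hz.1)
        · intro z hz
          have := hz.2.1
          simp only [mem_ofPred_eq]
          linarith
      have h2 : ContinuousOn (fun z => - g z) N := by
        apply Continuous.continuousOn
        simp only [hg]
        fun_prop
      simpa only [sub_eq_add_neg] using h1.add h2.upperSemicontinuousOn
    obtain ⟨⟨ξ, s⟩, hm, hmax⟩ := husc'.exists_isMaxOn ⟨_, hηN⟩ hNc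
    have hs0 : 0 < s := by have := hm.2.1; simp only at this; linarith
    have hsS : s < S := by have := hm.2.2; simp only at this; linarith
    have h1 := hmax hηN
    have h2 := hmax hxN
    simp only [mem_ofPred_eq, hg, sub_self, norm_zero, mul_zero, ne_eq, OfNat.ofNat_ne_zero,
      not_false_eq_true, zero_pow, add_zero, sub_zero, hη, hinv y hys, hinv x hxs] at h1 h2
    rw [← hη] at h1 h2
    have hRξ := abs_le.1 (hR (e.symm ξ) s hs0 hsS)
    have hRy := abs_le.1 (hR y t ht0 htS)
    have hsum : L * ‖ξ - η‖ + κ * (s - t) ^ 2 ≤ 2 * R := by linarith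
    have hξ1 : ‖ξ - η‖ < 2 * ρ := by
      have h3 : L * ‖ξ - η‖ < L * (2 * ρ) := by nlinarith [sq_nonneg (s - t), mul_pos hL0 hρ]
      exact lt_of_mul_lt_mul_left h3 hL0.le
    have hs1 : |s - t| < a := by
      have h3 : κ * (s - t) ^ 2 < κ * a ^ 2 := by
        have : 0 ≤ L * ‖ξ - η‖ := by positivity
        linarith
      exact abs_lt_of_sq_lt_sq (lt_of_mul_lt_mul_left h3 hκ.le) ha0.le
    -- At the apex the time-Lipschitz bound controls the error by `C ^ 2 / κ`. Away from it the cone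
    -- is a legitimate test function whose gradient is too large.
    by_cases hξη : ξ = η
    · subst hξη
      have h3 : e.symm η = y := by rw [hη, hinv y hys]
      rw [h3] at h2
      have h4 := (abs_le.1 (hC y s t hs0 hsS ht0 htS)).2
      have h5 : C * |s - t| - κ * (s - t) ^ 2 ≤ C ^ 2 / κ := by
        rw [le_div_iff₀ hκ, ← sq_abs (s - t)]
        nlinarith [sq_nonneg (C - κ * |s - t| * 2), sq_nonneg (κ * |s - t|), sq_nonneg C]
      rw [dist_eq_norm]
      simp only [sub_self, norm_zero, mul_zero, zero_add] at h2
      linarith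
    · exfalso
      have hmem : ξ ∈ Metric.closedBall (e c) ρ' := hball hm.1
      set x₁ := e.symm ξ with hx₁
      have hx₁s : x₁ ∈ (chartAt (Model n) c).source := by
        have := e.map_target (htar hmem)
        rwa [he, extChartAt_source] at this
      have hex₁ : e x₁ = ξ := e.right_inv (htar hmem)
      have hξη' : ξ - η ≠ 0 := sub_ne_zero.2 hξη
      have hnd : ContDiffAt ℝ 1 (fun v : Model n => ‖v‖) (ξ - η) := contDiffAt_norm ℝ hξη'
      have hgC : ContDiffAt ℝ 1 g (e x₁, s) := by
        rw [hex₁]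
        have h3 : ContDiffAt ℝ 1 (fun z : Model n × ℝ => ‖z.1 - η‖) (ξ, s) :=
          ContDiffAt.comp (g := fun v : Model n => ‖v‖) (f := fun z : Model n × ℝ => z.1 - η)
            (ξ, s) hnd (by fun_prop)
        exact (contDiffAt_const.mul h3).add (by fun_prop)
      have hlm : IsLocalMax (fun z => w z - g (e z.1, z.2)) (x₁, s) := by
        have hNn : N ∈ 𝓝 (e x₁, s) := by
          rw [hex₁]
          refine prod_mem_nhds (Metric.closedBall_mem_nhds_of_mem ?_) (Icc_mem_nhds ?_ ?_)
          · rwa [Metric.mem_ball, dist_eq_norm]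
          · linarith [(abs_lt.1 hs1).1]
          · linarith [(abs_lt.1 hs1).2]
        have h3 := eventually_chart_of_eventually_model hx₁s (t := s) hNn
        have h4 : ∀ᶠ z : M × ℝ in 𝓝 (x₁, s), z.1 ∈ e.source :=
          continuous_fst.continuousAt.eventually
            ((isOpen_extChartAt_source c).mem_nhds (by rw [extChartAt_source]; exact hx₁s))
        filter_upwards [h3, h4] with z hz hz'
        have h5 := hmax hz
        simp only [mem_ofPred_eq] at h5
        rw [hinv _ hz'] at h5
        rw [hex₁]
        exact h5
      have h6 := hgrad w (fun z => g (e z.1, z.2)) x₁ s (hsub _ hs0) (hR _ _ hs0 hsS) (by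
        filter_upwards [eventually_lt_nhds hsS] with r hrS hr
        have h7 := (abs_le.1 (hC x₁ r s (hs0.trans hr) hrS hs0 hsS)).1
        rw [abs_of_pos (sub_pos.2 hr)] at h7
        linarith) (contMDiffAt_comp_chart hx₁s hgC) hlm
      rw [mvfderiv_eq_of_chart c x₁ s _ g hx₁s (hgC.differentiableAt one_ne_zero)
        (Eventually.of_forall fun _ => rfl)] at h6
      set p := (fderiv ℝ g (extChartAt (𝓡 n) c x₁, s)).comp
        (ContinuousLinearMap.inl ℝ (Model n) ℝ) with hp
      have h7 := hcov' ξ hmem p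
      have h8 : p (ξ - η) = L * ‖ξ - η‖ := by
        have h9 : HasFDerivAt (fun v : Model n => g (v, s)) p (e x₁) :=
          (hgC.differentiableAt one_ne_zero).hasFDerivAt.comp (f := fun v => (v, s)) _
            (hasFDerivAt_prodMk_left _ _)
        rw [hex₁] at h9
        have h10 : HasFDerivAt (fun v : Model n => g (v, s))
            (L • fderiv ℝ (fun v : Model n => ‖v‖) (ξ - η)) ξ := by
          have h11 := (hnd.differentiableAt one_ne_zero).hasFDerivAt.comp ξ
            (hasFDerivAt_sub_const η)
          exact (h11.const_mul L).add_const (κ * (s - t) ^ 2)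
        rw [h9.unique h10]
        rw [smul_apply, smul_eq_mul,
          (hnd.differentiableAt one_ne_zero).fderiv_norm_self]
      have h12 := (le_abs_self _).trans (p.le_opNorm (ξ - η))
      rw [h8] at h12
      have h13 : L ≤ ‖p‖ := le_of_mul_le_mul_right h12 (norm_pos_iff.2 hξη')
      have h14 : D * ‖(chartCovector c x₁ p : CotangentSpace n x₁)‖ ≤ D * K := by gcongr
      linarith
  -- `L` and the neighbourhood do not depend on `κ`, so the time penalty can be sent to infinity.
  have hlim : Tendsto (fun κ : ℝ => L * dist (e x) η + C ^ 2 / κ) atTop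
      (𝓝 (L * dist (e x) η + 0)) :=
    tendsto_const_nhds.add (tendsto_const_nhds.div_atTop tendsto_id)
  rw [add_zero] at hlim
  refine ge_of_tendsto hlim ?_
  filter_upwards [eventually_gt_atTop (0 : ℝ), eventually_gt_atTop (2 * R / a ^ 2)] with κ h1 h2
  exact key κ h1 ((div_lt_iff₀ (by positivity)).1 h2)

/-- A time-Lipschitz subsolution of a coercive equation is Lipschitz in space. -/
theorem exists_abs_sub_le_mul_dist [IsRiemannianManifold (𝓡 n) M] [CompactSpace M]
    {H : Hamiltonian n M} (hH : Coercive H)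
    {w : M × ℝ → ℝ} {S R C : ℝ} (hsub : ∀ z : M × ℝ, 0 < z.2 → SubsolutionAt H w z)
    (husc : UpperSemicontinuousOn w {z | 0 < z.2})
    (hR : ∀ (x : M) (t : ℝ), 0 < t → t < S → |w (x, t)| ≤ R)
    (hC : ∀ (x : M) (s t : ℝ), 0 < s → s < S → 0 < t → t < S →
      |w (x, s) - w (x, t)| ≤ C * |s - t|) :
    ∃ K : ℝ, 0 ≤ K ∧ ∀ (t : ℝ), 0 < t → t < S → ∀ x y : M,
      |w (x, t) - w (y, t)| ≤ K * dist x y := by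
  obtain ⟨K, hK, h⟩ := exists_forall_abs_sub_le_of_locally
    (f := fun (t : Ioo (0 : ℝ) S) (x : M) => w (x, t)) (R := R)
    (fun t x => hR x t t.2.1 t.2.2) (fun c => by
      obtain ⟨L, U, hU, h1⟩ := exists_sub_le_mul_dist_extChartAt hH hsub husc hR hC c
      obtain ⟨D, hD, δ, hδ, h2⟩ := exists_dist_extChartAt_le (𝓡 n) c
      refine ⟨|L| * D, U ∩ Metric.ball c δ, inter_mem hU (Metric.ball_mem_nhds _ hδ), ?_⟩
      have h3 : ∀ x ∈ U ∩ Metric.ball c δ, ∀ y ∈ U ∩ Metric.ball c δ, ∀ t : Ioo (0 : ℝ) S,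
          w (x, t) - w (y, t) ≤ |L| * D * dist x y := by
        intro x hx y hy t
        calc w (x, t) - w (y, t) ≤ L * dist (extChartAt (𝓡 n) c x) (extChartAt (𝓡 n) c y) :=
              h1 x hx.1 y hy.1 t t.2.1 t.2.2
          _ ≤ |L| * (D * dist x y) :=
              mul_le_mul (le_abs_self L) (h2 x hx.2 y hy.2) dist_nonneg (abs_nonneg L)
          _ = _ := by ring
      intro x hx y hy t
      rw [abs_le]
      have h4 := h3 x hx y hy t
      have h5 := h3 y hy x hx t
      rw [dist_comm] at h5
      constructor <;> linarith)
  exact ⟨K, hK, fun t h0 hS x y => h ⟨t, h0, hS⟩ x y⟩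

end Lipschitz

/-! ### Stability under suprema and the bump construction -/

section Perturbation

variable {n : ℕ} {M : Type*} [MetricSpace M] [ChartedSpace (Model n) M]

/-- A `C¹` function near `z` with a strict minimum at `z`. -/
theorem exists_isC1At_strict_min [IsManifold (𝓡 n) 1 M] (z : M × ℝ) :
    ∃ q : M × ℝ → ℝ, q z = 0 ∧ (∀ y, 0 ≤ q y) ∧
      ∀ᶠ y in 𝓝 z, IsC1At n q y ∧ (y ≠ z → 0 < q y) := by
  obtain ⟨x, t⟩ := z
  refine ⟨fun y => ‖extChartAt (𝓡 n) x y.1 - extChartAt (𝓡 n) x x‖ ^ 2 + (y.2 - t) ^ 2,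
    by simp, fun y => by positivity, ?_⟩
  have h : ∀ᶠ y : M × ℝ in 𝓝 (x, t), y.1 ∈ (chartAt (Model n) x).source :=
    continuous_fst.continuousAt.eventually (chart_source_mem_nhds (Model n) x)
  filter_upwards [h] with y hy
  constructor
  · refine contMDiffAt_comp_chart (g := fun z : Model n × ℝ =>
      ‖z.1 - extChartAt (𝓡 n) x x‖ ^ 2 + (z.2 - t) ^ 2) hy ?_
    exact ((contDiff_fst.sub contDiff_const).norm_sq ℝ).contDiffAt.add (by fun_prop)
  · intro hne
    by_contra hle
    have h1 : ‖extChartAt (𝓡 n) x y.1 - extChartAt (𝓡 n) x x‖ ^ 2 = 0 := by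
      nlinarith [sq_nonneg (‖extChartAt (𝓡 n) x y.1 - extChartAt (𝓡 n) x x‖), sq_nonneg (y.2 - t)]
    have h2 : (y.2 - t) ^ 2 = 0 := by
      nlinarith [sq_nonneg (‖extChartAt (𝓡 n) x y.1 - extChartAt (𝓡 n) x x‖), sq_nonneg (y.2 - t)]
    have h3 := sub_eq_zero.1 (norm_eq_zero.1 (pow_eq_zero_iff (two_ne_zero)|>.1 h1))
    have h4 := sub_eq_zero.1 (pow_eq_zero_iff (two_ne_zero)|>.1 h2)
    have h5 := (extChartAt (𝓡 n) x).injOn (by simpa using hy) (mem_extChartAt_source x) h3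
    exact hne (Prod.ext h5 h4)

/-- A compact neighbourhood on whose boundary `q` is bounded below. -/
theorem exists_compact_nhds_of_strict_min [CompactSpace M] {z : M × ℝ} {q : M × ℝ → ℝ} {U : Set (M × ℝ)}
    (hq : ∀ᶠ y in 𝓝 z, IsC1At n q y ∧ (y ≠ z → 0 < q y)) (hU : U ∈ 𝓝 z) :
    ∃ N ∈ 𝓝 z, IsCompact N ∧ N ⊆ U ∧ ∃ m > 0, ∀ y ∈ N, q y < m → y ∈ interior N := by
  obtain ⟨N, hN, hNU, hNc⟩ := local_compact_nhds (inter_mem hU hq)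
  refine ⟨N, hN, hNc, fun y hy => (hNU hy).1, ?_⟩
  have hfr : frontier N ⊆ N := hNc.isClosed.frontier_subset
  have hout : ∀ y ∈ N, y ∉ interior N → y ∈ frontier N := fun y hy hy' =>
    ⟨subset_closure hy, hy'⟩
  rcases (frontier N).eq_empty_or_nonempty with h | h
  · refine ⟨1, one_pos, fun y hy _ => ?_⟩
    by_contra hy'
    have := hout y hy hy'
    rw [h] at this
    exact this
  · have hc : ContinuousOn q (frontier N) := fun y hy =>
      ((hNU (hfr hy)).2.1.continuousAt).continuousWithinAt
    obtain ⟨y₀, hy₀, hmin⟩ := (hNc.of_isClosed_subset isClosed_frontier hfr).exists_isMinOn h hc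
    refine ⟨q y₀, (hNU (hfr hy₀)).2.2 ?_, fun y hy hlt => ?_⟩
    · rintro rfl
      exact hy₀.2 (mem_interior_iff_mem_nhds.2 hN)
    · by_contra hy'
      exact absurd (hmin (hout y hy hy')) (not_le.2 hlt)

variable [CompactSpace M] [IsManifold (𝓡 n) 1 M]

/-- Stability of subsolutions under (relaxed) suprema. -/
theorem subsolutionAt_of_approx {H : Hamiltonian n M} (hH : JointlyContinuous H)
    {F : Set (M × ℝ → ℝ)} {W : M × ℝ → ℝ} {z₀ : M × ℝ} (hz₀ : 0 < z₀.2)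
    (hsub : ∀ w ∈ F, ∀ z : M × ℝ, 0 < z.2 → SubsolutionAt H w z)
    (husc : ∀ w ∈ F, UpperSemicontinuousOn w {z | 0 < z.2})
    (hle : ∀ w ∈ F, ∀ z : M × ℝ, 0 < z.2 → w z ≤ W z)
    (happ : ∀ ε > 0, ∀ U ∈ 𝓝 z₀, ∃ y ∈ U, ∃ w ∈ F, W z₀ - ε < w y) :
    SubsolutionAt H W z₀ := by
  intro ψ hψ hmax
  by_contra hpos
  rw [not_le] at hpos
  obtain ⟨q, hq0, hqnn, hq⟩ := exists_isC1At_strict_min (n := n) z₀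
  -- Adding `q` makes the maximum at `z₀` strict without changing the differential there.
  set ψ' : M × ℝ → ℝ := fun y => ψ y + q y with hψ'
  have hψ'C : IsC1At n ψ' z₀ := hψ.add hq.self_of_nhds.1
  have hψ'0 : ψ' z₀ = ψ z₀ := by simp [hψ', hq0]
  have hexp : hjExpr H ψ' z₀.1 z₀.2 (W z₀) = hjExpr H ψ z₀.1 z₀.2 (W z₀) := by
    refine hjExpr_eq_of_isLocalMax_sub H hψ'C hψ (Eventually.of_forall fun y => ?_) _
    have := hqnn y
    simp only [hψ', hq0]
    linarith
  have hcont := continuousAt_hjExpr hH hψ'C (W z₀)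
  have hpos' : ∀ᶠ p in 𝓝 (z₀, W z₀), 0 < hjExpr H ψ' p.1.1 p.1.2 p.2 :=
    hcont.eventually (lt_mem_nhds (by simpa only [hexp] using hpos))
  rw [nhds_prod_eq, Metric.eventually_prod_nhds_iff] at hpos'
  obtain ⟨P, hP, η, hη, hPη⟩ := hpos'
  set b := W z₀ - ψ z₀ with hb
  have hU : ∀ᶠ y in 𝓝 z₀, (0 < y.2 ∧ P y) ∧ (W y - ψ y ≤ b ∧ IsC1At n ψ' y) ∧
      |ψ' y - ψ' z₀| < η / 2 := by
    refine ((continuous_snd.continuousAt.eventually (lt_mem_nhds hz₀)).and hP).and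
      ((Eventually.and hmax ((contMDiffAt_iff_contMDiffAt_nhds (by simp)).1 hψ'C)).and ?_)
    have := hψ'C.continuousAt.eventually (Metric.ball_mem_nhds (ψ' z₀) (half_pos hη))
    simpa only [Metric.mem_ball, Real.dist_eq] using this
  obtain ⟨N, hN, hNc, hNU, m, hm, hNm⟩ := exists_compact_nhds_of_strict_min hq hU
  -- At a maximum `z` of `w - ψ'` over `N` one gets `q z < 2 * ε`. This forces `z` into the
  -- interior, and `w z` within `η` of `W z₀`, where the expression is still positive.
  set ε := min m (η / 2) / 3 with hε
  have hε0 : 0 < ε := by positivity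
  have hεm : 2 * ε < m := by
    have := min_le_left m (η / 2); linarith
  have hεη : 2 * ε < η / 2 := by
    have := min_le_right m (η / 2); linarith
  have hN' : ∀ᶠ y in 𝓝 z₀, y ∈ N ∧ |ψ' y - ψ' z₀| < ε := by
    refine Eventually.and hN ?_
    have := hψ'C.continuousAt.eventually (Metric.ball_mem_nhds (ψ' z₀) hε0)
    simpa only [Metric.mem_ball, Real.dist_eq] using this
  obtain ⟨y, ⟨hyN, hyψ⟩, w, hwF, hwy⟩ := happ ε hε0 _ hN'
  have husc' : UpperSemicontinuousOn (fun z => w z - ψ' z) N := by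
    have h1 : UpperSemicontinuousOn w N := (husc w hwF).mono fun z hz => (hNU hz).1.1
    have h2 : ContinuousOn (fun z => - ψ' z) N := fun z hz =>
      ((hNU hz).2.1.2.continuousAt).continuousWithinAt.neg
    simpa only [sub_eq_add_neg] using h1.add h2.upperSemicontinuousOn
  obtain ⟨z, hzN, hzmax⟩ := husc'.exists_isMaxOn ⟨y, hyN⟩ hNc
  obtain ⟨⟨hz0, hPz⟩, ⟨hWz, -⟩, hψz⟩ := hNU hzN
  have h1 := hzmax hyN
  simp only [mem_ofPred_eq] at h1
  have h2 := abs_lt.1 hyψ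
  have h3 := hle w hwF z hz0
  have h4 : ψ' z = ψ z + q z := rfl
  have hzint : z ∈ interior N := hNm z hzN (by linarith)
  have h5 := hsub w hwF z hz0 ψ' (hNU hzN).2.1.2 (by
    filter_upwards [mem_interior_iff_mem_nhds.1 hzint] with a ha
    exact hzmax ha)
  have h6 := abs_lt.1 hψz
  have h7 := hqnn z
  have h8 := hPη hPz (x := w z) (by
    rw [Real.dist_eq, abs_lt]
    constructor <;> linarith)
  exact absurd h5 (not_le.2 h8)

/-- A subsolution that is not a supersolution at a point can be raised at that point. -/
theorem exists_larger_subsolution {H : Hamiltonian n M} (hH : JointlyContinuous H)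
    {u B : M × ℝ → ℝ} {z₀ : M × ℝ} (hz₀ : 0 < z₀.2)
    (hsub : ∀ z : M × ℝ, 0 < z.2 → SubsolutionAt H u z)
    (hu : ∀ z : M × ℝ, 0 < z.2 → ContinuousAt u z)
    (hB : ContinuousAt B z₀) (huB : u z₀ < B z₀) (hnot : ¬ SupersolutionAt H u z₀) :
    ∃ w : M × ℝ → ℝ, (∀ z : M × ℝ, 0 < z.2 → SubsolutionAt H w z) ∧
      UpperSemicontinuousOn w {z | 0 < z.2} ∧ u z₀ < w z₀ ∧
      ∀ z, w z = u z ∨ (0 < z.2 ∧ w z ≤ B z) := by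
  classical
  simp only [SupersolutionAt, not_forall, not_le] at hnot
  obtain ⟨ψ, hψ, hmin, hneg⟩ := hnot
  obtain ⟨q, hq0, hqnn, hq⟩ := exists_isC1At_strict_min (n := n) z₀
  set b := u z₀ - ψ z₀ with hb
  -- `G` touches `u` from below at `z₀`, strictly nearby, and is a strict classical subsolution
  -- around `z₀`.
  set G : M × ℝ → ℝ := fun y => (ψ y + b) - q y with hG
  have hψb : IsC1At n (fun y => ψ y + b) z₀ := hψ.add (isC1At_const b z₀)
  have hGC : IsC1At n G z₀ := hψb.sub hq.self_of_nhds.1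
  have hG0 : G z₀ = u z₀ := by simp [hG, hq0, hb]
  have hexp : hjExpr H G z₀.1 z₀.2 (u z₀) = hjExpr H ψ z₀.1 z₀.2 (u z₀) := by
    rw [← hjExpr_add_const H (x := z₀.1) (t := z₀.2) hψ b]
    refine (hjExpr_eq_of_isLocalMax_sub H hψb hGC (Eventually.of_forall fun y => ?_) _).symm
    have := hqnn y
    simp only [hG, hq0]
    linarith
  have hcont := continuousAt_hjExpr hH hGC (u z₀)
  have hneg' : ∀ᶠ p in 𝓝 (z₀, u z₀), hjExpr H G p.1.1 p.1.2 p.2 < 0 :=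
    hcont.eventually (gt_mem_nhds (by simpa only [hexp] using hneg))
  rw [nhds_prod_eq, Metric.eventually_prod_nhds_iff] at hneg'
  obtain ⟨P, hP, η, hη, hPη⟩ := hneg'
  set η' := (B z₀ - u z₀) / 2 with hη'
  have hη'0 : 0 < η' := by linarith
  have hU : ∀ᶠ y in 𝓝 z₀, (0 < y.2 ∧ P y) ∧ (u z₀ - ψ z₀ ≤ u y - ψ y ∧ IsC1At n G y) ∧
      (|G y - u z₀| < η / 2 ∧ G y + η' < B y) := by
    refine ((continuous_snd.continuousAt.eventually (lt_mem_nhds hz₀)).and hP).and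
      ((Eventually.and hmin ((contMDiffAt_iff_contMDiffAt_nhds (by simp)).1 hGC)).and
        (Eventually.and ?_ ?_))
    · have := hGC.continuousAt.eventually (Metric.ball_mem_nhds (G z₀) (half_pos hη))
      simpa only [Metric.mem_ball, Real.dist_eq, hG0] using this
    · have h1 : ContinuousAt (fun y => B y - G y) z₀ := hB.sub hGC.continuousAt
      filter_upwards [h1.eventually (lt_mem_nhds (show η' < B z₀ - G z₀ by
        rw [hG0]; linarith))] with y hy
      linarith
  obtain ⟨N, hN, hNc, hNU, m, hm, hNm⟩ := exists_compact_nhds_of_strict_min hq hU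
  -- The three bounds make `G + ε` fall below `u` near the edge of `N`, keep it a subsolution on
  -- `N`, and keep it below `B`.
  set ε := min m (min (η / 2) η') / 2 with hε
  have hε0 : 0 < ε := by positivity
  have hεm : ε < m := by
    have := min_le_left m (min (η / 2) η'); linarith
  have hεη : ε < η / 2 := by
    have := (min_le_right m (min (η / 2) η')).trans (min_le_left _ _); linarith
  have hεη' : ε < η' := by
    have := (min_le_right m (min (η / 2) η')).trans (min_le_right _ _); linarith
  set w : M × ℝ → ℝ := fun z => if z ∈ N then max (u z) (G z + ε) else u z with hw
  have huw : ∀ z, u z ≤ w z := fun z => by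
    simp only [hw]
    split_ifs
    exacts [le_max_left _ _, le_rfl]
  have hwN : ∀ z ∈ N, w z = max (u z) (G z + ε) := fun z hz => by simp only [hw, if_pos hz]
  have hint : ∀ z ∈ N, u z ≤ G z + ε → z ∈ interior N := by
    intro z hz hle
    refine hNm z hz ?_
    have h1 := (hNU hz).2.1.1
    have h2 : G z = ψ z + b - q z := rfl
    linarith
  refine ⟨w, ?_, ?_, ?_, ?_⟩
  · intro z hz
    by_cases h : z ∈ N ∧ u z < G z + ε
    · obtain ⟨hzN, hlt⟩ := h
      have hzi := hint z hzN hlt.le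
      have hwz : w z = G z + ε := by rw [hwN z hzN, max_eq_right hlt.le]
      have hGz := (hNU hzN).2.1.2
      have hsubG : SubsolutionAt H (fun y => G y + ε) z := by
        refine subsolutionAt_of_hjExpr_nonpos (hGz.add (isC1At_const ε z)) ?_
        rw [hjExpr_add_const H (x := z.1) (t := z.2) hGz]
        refine (hPη (hNU hzN).1.2 ?_).le
        have h6 := abs_lt.1 (hNU hzN).2.2.1
        rw [Real.dist_eq, abs_lt]
        constructor <;> linarith
      refine hsubG.of_le ?_ hwz.symm
      filter_upwards [mem_interior_iff_mem_nhds.1 hzi] with y hy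
      rw [hwN y hy]
      exact le_max_right _ _
    · refine (hsub z hz).of_le (Eventually.of_forall huw) ?_
      by_cases hzN : z ∈ N
      · rw [hwN z hzN, max_eq_left]
        by_contra hlt
        exact h ⟨hzN, not_le.1 hlt⟩
      · simp only [hw, if_neg hzN]
  · intro z hz
    have hcw : ContinuousAt w z := by
      by_cases hzi : z ∈ interior N
      · have hGz := (hNU (interior_subset hzi)).2.1.2
        have h0 : ContinuousAt (fun y => max (u y) (G y + ε)) z :=
          (hu z hz).max (hGz.continuousAt.add continuousAt_const)
        refine h0.congr ?_
        filter_upwards [mem_interior_iff_mem_nhds.1 hzi] with y hy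
        exact (hwN y hy).symm
      · refine (hu z hz).congr ?_
        by_cases hzN : z ∈ N
        · have hlt : G z + ε < u z := by
            by_contra hle
            exact hzi (hint z hzN (not_lt.1 hle))
          have hGz := (hNU hzN).2.1.2
          have h1 : ContinuousAt (fun y => u y - (G y + ε)) z :=
            (hu z hz).sub (hGz.continuousAt.add continuousAt_const)
          filter_upwards [h1.eventually (lt_mem_nhds (sub_pos.2 hlt))] with y hy
          simp only [hw]
          split_ifs
          · rw [max_eq_left (sub_pos.1 hy).le]
          · rfl
        · filter_upwards [hNc.isClosed.isOpen_compl.mem_nhds hzN] with y hy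
          have : y ∉ N := hy
          simp only [hw, if_neg this]
    exact hcw.upperSemicontinuousAt.upperSemicontinuousWithinAt _
  · rw [hwN z₀ (mem_of_mem_nhds hN)]
    refine lt_of_lt_of_le ?_ (le_max_right _ _)
    rw [hG0]
    linarith
  · intro z
    by_cases hzN : z ∈ N
    · rw [hwN z hzN]
      rcases le_total (G z + ε) (u z) with h | h
      · exact Or.inl (max_eq_left h)
      · refine Or.inr ⟨(hNU hzN).1.1, ?_⟩
        rw [max_eq_right h]
        have := (hNU hzN).2.2.2
        linarith
    · left
      simp only [hw, if_neg hzN]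

end Perturbation

/-! ### Barriers, the Perron family and its time translations -/

/-- The time profile `C (e^{Lt} - 1) / L` of the barriers. -/
noncomputable def barrierTime (C L t : ℝ) : ℝ := C / L * (Real.exp (L * t) - 1)

theorem barrierTime_zero (C L : ℝ) : barrierTime C L 0 = 0 := by simp [barrierTime]

theorem contDiff_barrierTime (C L : ℝ) : ContDiff ℝ 1 (barrierTime C L) := by
  unfold barrierTime; fun_prop

/-- Since `C e^{Lt} = C + L f(t)`, the profile `f` solves `f' = C + L f`. -/
theorem deriv_barrierTime (C : ℝ) {L : ℝ} (hL : 0 < L) (t : ℝ) :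
    deriv (barrierTime C L) t = C * Real.exp (L * t) := by
  have h1 : HasDerivAt (fun s : ℝ => L * s) L t := by
    simpa using (hasDerivAt_id t).const_mul L
  have h2 : HasDerivAt (barrierTime C L) (C / L * (Real.exp (L * t) * L)) t :=
    (h1.exp.sub_const 1).const_mul (C / L)
  rw [h2.deriv]
  field_simp

theorem barrierTime_mono {C L : ℝ} (hC : 0 ≤ C) (hL : 0 < L) : Monotone (barrierTime C L) := by
  intro s t hst
  unfold barrierTime
  gcongr

theorem barrierTime_nonneg {C L : ℝ} (hC : 0 ≤ C) (hL : 0 < L) {t : ℝ} (ht : 0 ≤ t) :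
    0 ≤ barrierTime C L t := by
  have := barrierTime_mono hC hL ht
  rwa [barrierTime_zero] at this

theorem barrierTime_sub_le {C L : ℝ} (hC : 0 ≤ C) (hL : 0 < L) {s t S : ℝ} (hst : s ≤ t)
    (htS : t ≤ S) :
    barrierTime C L t - barrierTime C L s ≤ C * Real.exp (L * S) * (t - s) := by
  have h1 : Real.exp (L * s) = Real.exp (L * t) * Real.exp (-(L * (t - s))) := by
    rw [← Real.exp_add]; ring_nf
  have h2 := Real.add_one_le_exp (-(L * (t - s)))
  have h3 : Real.exp (L * t) ≤ Real.exp (L * S) := by gcongr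
  have h4 : Real.exp (L * t) - Real.exp (L * s) ≤ Real.exp (L * S) * (L * (t - s)) := by
    have h5 : 0 ≤ L * (t - s) := mul_nonneg hL.le (sub_nonneg.2 hst)
    calc Real.exp (L * t) - Real.exp (L * s)
        = Real.exp (L * t) * (1 - Real.exp (-(L * (t - s)))) := by rw [h1]; ring
      _ ≤ Real.exp (L * t) * (L * (t - s)) := by gcongr; linarith
      _ ≤ _ := by gcongr
  calc barrierTime C L t - barrierTime C L s
      = C / L * (Real.exp (L * t) - Real.exp (L * s)) := by unfold barrierTime; ring
    _ ≤ C / L * (Real.exp (L * S) * (L * (t - s))) := by gcongr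
    _ = _ := by field_simp

section Barrier

variable {n : ℕ} {M : Type*} [TopologicalSpace M] [ChartedSpace (Model n) M]

theorem hjExpr_space_add_time {H : Hamiltonian n M} {φ : M → ℝ}
    (hφ : ContMDiff (𝓡 n) 𝓘(ℝ, ℝ) 1 φ) {f : ℝ → ℝ} (hf : ContDiff ℝ 1 f) (x : M) (t r : ℝ) :
    hjExpr H (fun z => φ z.1 + f z.2) x t r = deriv f t + H x (mvfderiv (𝓡 n) φ x) r := by
  rw [hjExpr_add_time H (isC1At_space hφ (x, t)) (hf.differentiable one_ne_zero t)]
  simp only [hjExpr, deriv_const]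
  ring

theorem isC1At_space_add_time {φ : M → ℝ} (hφ : ContMDiff (𝓡 n) 𝓘(ℝ, ℝ) 1 φ) {f : ℝ → ℝ}
    (hf : ContDiff ℝ 1 f) (z : M × ℝ) : IsC1At n (fun z : M × ℝ => φ z.1 + f z.2) z :=
  (isC1At_space hφ z).add (isC1At_time hf.contDiffAt)

/-- The data of the Perron construction: `L` is the Lipschitz constant of `H` in `u` and `C` bounds
`H` along the initial datum. -/
structure BarrierData (H : Hamiltonian n M) (φ : M → ℝ) (C L : ℝ) : Prop where
  L_pos : 0 < L
  C_nonneg : 0 ≤ C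
  smooth : ContMDiff (𝓡 n) 𝓘(ℝ, ℝ) 1 φ
  lipschitz : ∀ (x : M) (p : CotangentSpace n x) (u v : ℝ), |H x p u - H x p v| ≤ L * |u - v|
  bound : ∀ x : M, |H x (mvfderiv (𝓡 n) φ x) (φ x)| ≤ C

variable {H : Hamiltonian n M} {φ : M → ℝ} {C L : ℝ}

/-- The lower barrier. -/
noncomputable def lowerBarrier (φ : M → ℝ) (C L : ℝ) (z : M × ℝ) : ℝ :=
  φ z.1 + -barrierTime C L z.2

/-- The upper barrier. -/
noncomputable def upperBarrier (φ : M → ℝ) (C L : ℝ) (z : M × ℝ) : ℝ :=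
  φ z.1 + barrierTime C L z.2

theorem BarrierData.continuous_lower (h : BarrierData H φ C L) :
    Continuous (lowerBarrier φ C L) :=
  (h.smooth.continuous.comp continuous_fst).add
    ((contDiff_barrierTime C L).continuous.comp continuous_snd).neg

theorem BarrierData.continuous_upper (h : BarrierData H φ C L) :
    Continuous (upperBarrier φ C L) :=
  (h.smooth.continuous.comp continuous_fst).add
    ((contDiff_barrierTime C L).continuous.comp continuous_snd)

/-- Between the barriers `|H|` along `Dφ` is at most `C + L f(t) = f'(t)`, which gives the sign of
the equation on both barriers. -/
theorem BarrierData.abs_hamiltonian_le (h : BarrierData H φ C L) (x : M) {t r : ℝ}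
    (hr : |r - φ x| ≤ barrierTime C L t) :
    |H x (mvfderiv (𝓡 n) φ x) r| ≤ C * Real.exp (L * t) := by
  have h1 := h.bound x
  have h2 := h.lipschitz x (mvfderiv (𝓡 n) φ x) r (φ x)
  have h3 : L * |r - φ x| ≤ C * (Real.exp (L * t) - 1) := by
    calc L * |r - φ x| ≤ L * barrierTime C L t := by gcongr; exact h.L_pos.le
      _ = _ := by
        have := h.L_pos.ne'
        unfold barrierTime
        field_simp
  have h4 := abs_sub_abs_le_abs_sub (H x (mvfderiv (𝓡 n) φ x) r) (H x (mvfderiv (𝓡 n) φ x) (φ x))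
  linarith

theorem BarrierData.subsolutionAt_lower [IsManifold (𝓡 n) 1 M] (h : BarrierData H φ C L)
    {z : M × ℝ} (hz : 0 ≤ z.2) : SubsolutionAt H (lowerBarrier φ C L) z := by
  have hf : ContDiff ℝ 1 (fun t => -barrierTime C L t) := (contDiff_barrierTime C L).neg
  refine subsolutionAt_of_hjExpr_nonpos (isC1At_space_add_time h.smooth hf z) ?_
  refine (hjExpr_space_add_time h.smooth hf _ _ _).trans_le ?_
  rw [deriv.fun_neg, deriv_barrierTime C h.L_pos]
  have := h.abs_hamiltonian_le z.1 (t := z.2) (r := lowerBarrier φ C L z) (by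
    simp [lowerBarrier, abs_of_nonneg (barrierTime_nonneg h.C_nonneg h.L_pos hz)])
  linarith [(abs_le.1 this).2]

theorem BarrierData.supersolutionAt_upper [IsManifold (𝓡 n) 1 M] (h : BarrierData H φ C L)
    {z : M × ℝ} (hz : 0 ≤ z.2) : SupersolutionAt H (upperBarrier φ C L) z := by
  have hf := contDiff_barrierTime C L
  refine supersolutionAt_of_hjExpr_nonneg (isC1At_space_add_time h.smooth hf z) ?_
  refine le_of_le_of_eq ?_ (hjExpr_space_add_time h.smooth hf _ _ _).symm
  rw [deriv_barrierTime C h.L_pos]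
  have := h.abs_hamiltonian_le z.1 (t := z.2) (r := upperBarrier φ C L z) (by
    simp [upperBarrier, abs_of_nonneg (barrierTime_nonneg h.C_nonneg h.L_pos hz)])
  linarith [(abs_le.1 this).1]

/-- The family of subsolutions below the upper barrier. -/
structure IsPerronSubsolution (H : Hamiltonian n M) (φ : M → ℝ) (C L : ℝ) (w : M × ℝ → ℝ) :
    Prop where
  sub : ∀ z : M × ℝ, 0 < z.2 → SubsolutionAt H w z
  usc : UpperSemicontinuousOn w {z | 0 < z.2}
  le : ∀ z : M × ℝ, 0 ≤ z.2 → w z ≤ upperBarrier φ C L z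

theorem BarrierData.isPerronSubsolution_lower [IsManifold (𝓡 n) 1 M] (h : BarrierData H φ C L) :
    IsPerronSubsolution H φ C L (lowerBarrier φ C L) where
  sub z hz := h.subsolutionAt_lower hz.le
  usc := h.continuous_lower.continuousOn.upperSemicontinuousOn
  le z hz := by
    have := barrierTime_nonneg h.C_nonneg h.L_pos hz
    simp only [lowerBarrier, upperBarrier]
    linarith

theorem upperSemicontinuousAt_shift {w : M × ℝ → ℝ}
    (hw : UpperSemicontinuousOn w {z | 0 < z.2}) (h κ L : ℝ) {z : M × ℝ} (hz : 0 < z.2 + h) :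
    UpperSemicontinuousAt (fun y => w (y.1, y.2 + h) - κ * Real.exp (L * y.2)) z := by
  have hopen : IsOpen {z : M × ℝ | 0 < z.2} := isOpen_lt continuous_const continuous_snd
  have h1 : UpperSemicontinuousAt w (z.1, z.2 + h) := by
    intro a ha
    have := hw (z.1, z.2 + h) hz a ha
    rwa [hopen.nhdsWithin_eq hz] at this
  have h2 : UpperSemicontinuousAt (fun y : M × ℝ => w (y.1, y.2 + h)) z :=
    h1.comp (f := w) (g := fun y : M × ℝ => (y.1, y.2 + h)) (by fun_prop)
  have h3 : ContinuousAt (fun y : M × ℝ => -(κ * Real.exp (L * y.2))) z := by fun_prop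
  simpa only [sub_eq_add_neg] using h2.add h3.upperSemicontinuousAt

/-- From `f(t + h) = f(t) + f(h) e^{Lt}`, subtracting `f(h) e^{Lt}` takes the advanced upper barrier
exactly back to the upper barrier. -/
theorem IsPerronSubsolution.shift_forward (hB : BarrierData H φ C L) {w : M × ℝ → ℝ}
    (hw : IsPerronSubsolution H φ C L w) {h : ℝ} (hh : 0 ≤ h) :
    IsPerronSubsolution H φ C L
      (fun y => w (y.1, y.2 + h) - barrierTime C L h * Real.exp (L * y.2)) where
  sub z hz := SubsolutionAt.shift hB.lipschitz (barrierTime_nonneg hB.C_nonneg hB.L_pos hh)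
    (hw.sub (z.1, z.2 + h) (by simp only; linarith))
  usc z hz := (upperSemicontinuousAt_shift hw.usc h _ L (by
    have : 0 < z.2 := hz
    linarith)).upperSemicontinuousWithinAt _
  le z hz := by
    have h1 := hw.le (z.1, z.2 + h) (by simp only; linarith)
    have h2 : barrierTime C L (z.2 + h) =
        barrierTime C L z.2 + barrierTime C L h * Real.exp (L * z.2) := by
      simp only [barrierTime, mul_add, Real.exp_add]
      ring
    simp only [upperBarrier, h2] at h1 ⊢
    linarith

/-- The delayed function makes sense only after time `h`, so the lower barrier fills in before. At
`t = h` the bound on the delayed function is `φ - f(h)`, the lower barrier itself, so the junction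
is upper semicontinuous. -/
theorem IsPerronSubsolution.shift_backward [IsManifold (𝓡 n) 1 M] (hB : BarrierData H φ C L)
    {w : M × ℝ → ℝ} (hw : IsPerronSubsolution H φ C L w) {h : ℝ} (hh : 0 < h) :
    IsPerronSubsolution H φ C L
      (fun y => if y.2 ≤ h then lowerBarrier φ C L y else
        max (lowerBarrier φ C L y)
          (w (y.1, y.2 - h) - (barrierTime C L y.2 - barrierTime C L (y.2 - h)))) := by
  -- This is `C / L * (1 - e^{-Lh})`, for which `f(t) - f(t - h) = κ e^{Lt}` has the form required
  -- by `SubsolutionAt.shift`.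
  set κ := -barrierTime C L (-h) with hκ
  have hκ0 : 0 ≤ κ := by
    have := barrierTime_mono hB.C_nonneg hB.L_pos (show -h ≤ 0 by linarith)
    rw [barrierTime_zero] at this
    linarith
  have hκe : ∀ t, barrierTime C L t - barrierTime C L (t - h) = κ * Real.exp (L * t) := by
    intro t
    simp only [hκ, barrierTime, mul_sub, Real.exp_sub, mul_neg, Real.exp_neg]
    field_simp
    ring
  set s : M × ℝ → ℝ := fun y => w (y.1, y.2 + -h) - κ * Real.exp (L * y.2) with hs
  have hse : ∀ y : M × ℝ, w (y.1, y.2 - h) - (barrierTime C L y.2 - barrierTime C L (y.2 - h)) =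
      s y := fun y => by rw [hκe, sub_eq_add_neg y.2 h]
  simp only [hse]
  set v : M × ℝ → ℝ := fun y => if y.2 ≤ h then lowerBarrier φ C L y else
    max (lowerBarrier φ C L y) (s y) with hv
  have hlow : ∀ y, lowerBarrier φ C L y ≤ v y := fun y => by
    simp only [hv]
    split_ifs
    exacts [le_rfl, le_max_left _ _]
  have hsup : ∀ y : M × ℝ, h ≤ y.2 → s y ≤ φ y.1 + barrierTime C L (y.2 - h) -
      (barrierTime C L y.2 - barrierTime C L (y.2 - h)) := by
    intro y hy
    rw [← hse]
    have := hw.le (y.1, y.2 - h) (by simp only; linarith)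
    simp only [upperBarrier] at this
    linarith
  have hopen : ∀ z : M × ℝ, h < z.2 → ∀ᶠ y : M × ℝ in 𝓝 z, h < y.2 := fun z hz =>
    continuous_snd.continuousAt.eventually (lt_mem_nhds hz)
  have hvgt : ∀ y : M × ℝ, h < y.2 → v y = max (lowerBarrier φ C L y) (s y) := fun y hy => by
    simp only [hv, if_neg (not_le.2 hy)]
  refine ⟨fun z hz => ?_, fun z hz => ?_, fun z hz => ?_⟩
  · by_cases hcase : h < z.2 ∧ lowerBarrier φ C L z < s z
    · have h1 : SubsolutionAt H s z := SubsolutionAt.shift hB.lipschitz hκ0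
        (hw.sub (z.1, z.2 + -h) (by simp only; linarith [hcase.1]))
      refine h1.of_le ?_ ?_
      · filter_upwards [hopen z hcase.1] with y hy
        rw [hvgt y hy]
        exact le_max_right _ _
      · rw [hvgt z hcase.1, max_eq_right hcase.2.le]
    · refine (hB.subsolutionAt_lower hz.le).of_le (Eventually.of_forall hlow) ?_
      by_cases hzh : h < z.2
      · rw [hvgt z hzh, max_eq_left]
        by_contra hlt
        exact hcase ⟨hzh, not_le.1 hlt⟩
      · simp only [hv, if_pos (not_lt.1 hzh)]
  · refine UpperSemicontinuousAt.upperSemicontinuousWithinAt _ ?_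
    by_cases hzh : h < z.2
    · have h1 : UpperSemicontinuousAt (fun y => max (lowerBarrier φ C L y) (s y)) z :=
        hB.continuous_lower.continuousAt.upperSemicontinuousAt.sup
          (upperSemicontinuousAt_shift hw.usc (-h) κ L (by linarith))
      intro a ha
      rw [hvgt z hzh] at ha
      filter_upwards [hopen z hzh, h1 a ha] with y hy hy'
      rwa [hvgt y hy]
    · intro a ha
      have hvz : v z = lowerBarrier φ C L z := by simp only [hv, if_pos (not_lt.1 hzh)]
      rw [hvz] at ha
      have h1 := hB.continuous_lower.continuousAt.eventually (gt_mem_nhds ha)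
      -- A continuous majorant of the delayed function after time `h`; it agrees with the lower
      -- barrier up to time `h`.
      set τ : M × ℝ → ℝ := fun y => φ y.1 + barrierTime C L (max (y.2 - h) 0) -
        (barrierTime C L y.2 - barrierTime C L (max (y.2 - h) 0)) with hτ
      have hτc : ContinuousAt τ z := by
        have h2 : Continuous (barrierTime C L) := (contDiff_barrierTime C L).continuous
        have h3 : Continuous φ := hB.smooth.continuous
        apply Continuous.continuousAt
        simp only [hτ]
        fun_prop
      have hτz : τ z = lowerBarrier φ C L z := by
        simp only [hτ, lowerBarrier, max_eq_right (sub_nonpos.2 (not_lt.1 hzh)), barrierTime_zero]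
        ring
      filter_upwards [h1, hτc.eventually (gt_mem_nhds (hτz.trans_lt ha))] with y hy hy'
      by_cases hyh : h < y.2
      · rw [hvgt y hyh]
        refine max_lt hy ((hsup y hyh.le).trans_lt ?_)
        simpa only [hτ, max_eq_left (sub_pos.2 hyh).le] using hy'
      · simp only [hv, if_pos (not_lt.1 hyh)]
        exact hy
  · by_cases hzh : h < z.2
    · rw [hvgt z hzh]
      refine max_le (hB.isPerronSubsolution_lower.le z hz) ((hsup z hzh.le).trans ?_)
      have h1 := barrierTime_mono hB.C_nonneg hB.L_pos (show z.2 - h ≤ z.2 by linarith)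
      simp only [upperBarrier]
      linarith
    · simp only [hv, if_pos (not_lt.1 hzh)]
      exact hB.isPerronSubsolution_lower.le z hz

end Barrier

/-! ### Time regularity of the Perron supremum -/

section PerronSup

variable {n : ℕ} {M : Type*} [TopologicalSpace M] [ChartedSpace (Model n) M]

/-- The supremum of the Perron family. -/
noncomputable def perronSup (H : Hamiltonian n M) (φ : M → ℝ) (C L : ℝ) (z : M × ℝ) : ℝ :=
  sSup ((fun w : M × ℝ → ℝ => w z) '' {w | IsPerronSubsolution H φ C L w})

variable {H : Hamiltonian n M} {φ : M → ℝ} {C L : ℝ}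

theorem IsPerronSubsolution.le_perronSup {w : M × ℝ → ℝ} (hw : IsPerronSubsolution H φ C L w)
    {z : M × ℝ} (hz : 0 ≤ z.2) : w z ≤ perronSup H φ C L z := by
  refine le_csSup ⟨upperBarrier φ C L z, ?_⟩ ⟨w, hw, rfl⟩
  rintro _ ⟨v, hv, rfl⟩
  exact hv.le z hz

variable [IsManifold (𝓡 n) 1 M]

theorem BarrierData.perronSup_le (hB : BarrierData H φ C L) {z : M × ℝ} {a : ℝ}
    (h : ∀ w, IsPerronSubsolution H φ C L w → w z ≤ a) : perronSup H φ C L z ≤ a := by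
  refine csSup_le ⟨_, _, hB.isPerronSubsolution_lower, rfl⟩ ?_
  rintro _ ⟨v, hv, rfl⟩
  exact h v hv

theorem BarrierData.exists_lt_of_lt_perronSup (hB : BarrierData H φ C L) {z : M × ℝ} {a : ℝ}
    (h : a < perronSup H φ C L z) : ∃ w, IsPerronSubsolution H φ C L w ∧ a < w z := by
  by_contra hne
  push Not at hne
  exact absurd (hB.perronSup_le hne) (not_le.2 h)

theorem BarrierData.lower_le_perronSup (hB : BarrierData H φ C L) {z : M × ℝ} (hz : 0 ≤ z.2) :
    lowerBarrier φ C L z ≤ perronSup H φ C L z :=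
  hB.isPerronSubsolution_lower.le_perronSup hz

theorem BarrierData.perronSup_le_upper (hB : BarrierData H φ C L) {z : M × ℝ} (hz : 0 ≤ z.2) :
    perronSup H φ C L z ≤ upperBarrier φ C L z :=
  hB.perronSup_le fun _ hw => hw.le z hz

theorem BarrierData.perronSup_zero (hB : BarrierData H φ C L) (x : M) :
    perronSup H φ C L (x, 0) = φ x := by
  have h1 := hB.lower_le_perronSup (z := (x, 0)) le_rfl
  have h2 := hB.perronSup_le_upper (z := (x, 0)) le_rfl
  simp only [lowerBarrier, upperBarrier, barrierTime_zero] at h1 h2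
  linarith

/-- Advancing a competitor by `t - s` carries its value at time `t` to time `s`, at the cost `f(t -
s) e^{Ls} = f(t) - f(s)`. -/
theorem BarrierData.perronSup_sub_le (hB : BarrierData H φ C L) (x : M) {s t : ℝ} (hs : 0 ≤ s)
    (hst : s ≤ t) :
    perronSup H φ C L (x, t) - perronSup H φ C L (x, s) ≤
      barrierTime C L t - barrierTime C L s := by
  rw [sub_le_iff_le_add]
  refine hB.perronSup_le fun w hw => ?_
  have h1 := (hw.shift_forward hB (sub_nonneg.2 hst)).le_perronSup (z := (x, s)) hs
  simp only [add_sub_cancel] at h1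
  have h2 : barrierTime C L t =
      barrierTime C L s + barrierTime C L (t - s) * Real.exp (L * s) := by
    have : Real.exp (L * t) = Real.exp (L * (t - s)) * Real.exp (L * s) := by
      rw [← Real.exp_add]; ring_nf
    simp only [barrierTime, this]
    ring
  linarith

theorem BarrierData.sub_perronSup_le (hB : BarrierData H φ C L) (x : M) {s t : ℝ} (hs : 0 ≤ s)
    (hst : s ≤ t) :
    perronSup H φ C L (x, s) - perronSup H φ C L (x, t) ≤
      barrierTime C L t - barrierTime C L s := by
  -- For `s = 0` the delay would be `t` itself, and the delayed competitor at time `t` is just the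
  -- lower barrier.
  rcases hs.eq_or_lt with rfl | hs
  · have h1 := hB.lower_le_perronSup (z := (x, t)) hst
    simp only [lowerBarrier] at h1
    rw [hB.perronSup_zero, barrierTime_zero]
    linarith
  rcases hst.eq_or_lt with rfl | hst
  · simp
  rw [sub_le_iff_le_add]
  refine hB.perronSup_le fun w hw => ?_
  have h1 := (hw.shift_backward hB (sub_pos.2 hst)).le_perronSup (z := (x, t)) (by
    simp only; linarith)
  simp only [if_neg (not_le.2 (show t - s < t by linarith)), sub_sub_cancel] at h1
  linarith [le_max_right (lowerBarrier φ C L (x, t))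
    (w (x, s) - (barrierTime C L t - barrierTime C L s))]

theorem BarrierData.abs_perronSup_sub_le (hB : BarrierData H φ C L) (x : M) {s t S : ℝ}
    (hs : 0 ≤ s) (hsS : s ≤ S) (ht : 0 ≤ t) (htS : t ≤ S) :
    |perronSup H φ C L (x, s) - perronSup H φ C L (x, t)| ≤
      C * Real.exp (L * S) * |s - t| := by
  wlog hst : s ≤ t generalizing s t
  · rw [abs_sub_comm, abs_sub_comm s t]
    exact this ht htS hs hsS (le_of_not_ge hst)
  have h1 := hB.perronSup_sub_le x hs hst
  have h2 := hB.sub_perronSup_le x hs hst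
  have h3 := barrierTime_sub_le hB.C_nonneg hB.L_pos hst htS
  rw [abs_of_nonpos (sub_nonpos.2 hst), abs_le]
  constructor <;> linarith

end PerronSup

/-! ### The Perron supremum solves the Cauchy problem -/

section Existence

variable {n : ℕ} {M : Type*} [MetricSpace M] [CompactSpace M] [ChartedSpace (Model n) M]
  [IsManifold (𝓡 n) 1 M] {H : Hamiltonian n M} {φ : M → ℝ} {C L : ℝ}

/-- The upper semicontinuous envelope of the Perron supremum still belongs to the family. -/
theorem BarrierData.exists_isPerronSubsolution_ge_perronSup (hB : BarrierData H φ C L)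
    (hH : JointlyContinuous H) :
    ∃ W, IsPerronSubsolution H φ C L W ∧ ∀ z : M × ℝ, 0 < z.2 → perronSup H φ C L z ≤ W z := by
  classical
  set u := perronSup H φ C L with hu
  have hpos : ∀ z : M × ℝ, 0 < z.2 → ∀ᶠ y : M × ℝ in 𝓝 z, 0 < y.2 := fun z hz =>
    continuous_snd.continuousAt.eventually (lt_mem_nhds hz)
  -- The local upper bounds of `u` at `z`; their infimum is the upper semicontinuous envelope.
  set A : M × ℝ → Set ℝ := fun z => {a | ∀ᶠ y in 𝓝 z, u y ≤ a} with hA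
  have hself : ∀ z a, a ∈ A z → u z ≤ a := fun z a ha => ha.self_of_nhds
  have hbdd : ∀ z, BddBelow (A z) := fun z => ⟨u z, fun a ha => hself z a ha⟩
  have hup : ∀ z : M × ℝ, 0 < z.2 → ∀ b, upperBarrier φ C L z < b → b ∈ A z := by
    intro z hz b hb
    filter_upwards [hpos z hz, hB.continuous_upper.continuousAt.eventually (gt_mem_nhds hb)]
      with y hy hy'
    exact (hB.perronSup_le_upper hy.le).trans hy'.le
  have hne : ∀ z : M × ℝ, 0 < z.2 → (A z).Nonempty := fun z hz =>
    ⟨upperBarrier φ C L z + 1, hup z hz _ (by linarith)⟩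
  -- At time `0` the value `φ` is that of the upper barrier, so membership in the family holds there
  -- too.
  set W : M × ℝ → ℝ := fun z => if 0 < z.2 then sInf (A z) else φ z.1 with hW
  have hWpos : ∀ z : M × ℝ, 0 < z.2 → W z = sInf (A z) := fun z hz => by simp only [hW, if_pos hz]
  have huW : ∀ z : M × ℝ, 0 < z.2 → u z ≤ W z := fun z hz => by
    rw [hWpos z hz]
    exact le_csInf (hne z hz) (hself z)
  refine ⟨W, ⟨?_, ?_, ?_⟩, huW⟩
  · intro z hz
    refine subsolutionAt_of_approx hH (F := {w | IsPerronSubsolution H φ C L w}) hz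
      (fun w hw => hw.sub) (fun w hw => hw.usc)
      (fun w hw y hy => (hw.le_perronSup hy.le).trans (huW y hy)) ?_
    intro ε hε U hU
    have h1 : W z - ε ∉ A z := by
      intro hmem
      have := csInf_le (hbdd z) hmem
      rw [← hWpos z hz] at this
      linarith
    simp only [hA, mem_ofPred_eq, not_eventually, not_le] at h1
    obtain ⟨y, hy, hyU⟩ := (h1.and_eventually hU).exists
    obtain ⟨w, hw, hlt⟩ := hB.exists_lt_of_lt_perronSup hy
    exact ⟨y, hyU, w, hw, hlt⟩
  · intro z hz
    refine UpperSemicontinuousAt.upperSemicontinuousWithinAt _ ?_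
    intro a ha
    rw [hWpos z hz] at ha
    obtain ⟨b, hb, hba⟩ := exists_lt_of_csInf_lt (hne z hz) ha
    filter_upwards [eventually_eventually_nhds.2 hb, hpos z hz] with y hy hy0
    rw [hWpos y hy0]
    exact (csInf_le (hbdd y) hy).trans_lt hba
  · intro z hz
    rcases hz.eq_or_lt with hz0 | hz0
    · simp only [hW, ← hz0, lt_irrefl, if_false, upperBarrier, barrierTime_zero, add_zero, le_refl]
    · rw [hWpos z hz0]
      exact le_of_forall_gt_imp_ge_of_dense fun b hb => csInf_le (hbdd z) (hup z hz0 b hb)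

/-- The envelope dominates the supremum and, being a member of the family, is dominated by it; the
two agree at positive times. -/
theorem BarrierData.isPerronSubsolution_perronSup (hB : BarrierData H φ C L)
    (hH : JointlyContinuous H) : (∀ z : M × ℝ, 0 < z.2 → SubsolutionAt H (perronSup H φ C L) z) ∧
      UpperSemicontinuousOn (perronSup H φ C L) {z | 0 < z.2} := by
  obtain ⟨W, hW, hle⟩ := hB.exists_isPerronSubsolution_ge_perronSup hH
  have heq : ∀ z : M × ℝ, 0 < z.2 → W z = perronSup H φ C L z := fun z hz =>
    le_antisymm (hW.le_perronSup hz.le) (hle z hz)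
  have hev : ∀ z : M × ℝ, 0 < z.2 → ∀ᶠ y in 𝓝 z, W y = perronSup H φ C L y := fun z hz => by
    filter_upwards [continuous_snd.continuousAt.eventually (lt_mem_nhds hz)] with y hy
    exact heq y hy
  refine ⟨fun z hz => (hW.sub z hz).of_le ((hev z hz).mono fun y hy => hy.le) (heq z hz), ?_⟩
  intro z hz a ha
  rw [← heq z hz] at ha
  filter_upwards [hW.usc z hz a ha, self_mem_nhdsWithin] with y hy hy0
  rwa [← heq y hy0]

theorem exists_barrierData (hH : JointlyContinuous H) (hL : EquiLipschitz H)
    (hφ : ContMDiff (𝓡 n) 𝓘(ℝ, ℝ) 1 φ) : ∃ C L : ℝ, BarrierData H φ C L := by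
  obtain ⟨L, hL0, hL⟩ := hL
  have h1 : Continuous fun x : M => H x (mvfderiv (𝓡 n) φ x) (φ x) := by
    -- Treating `φ` as constant in time reduces continuity to that of `hjExpr`; compactness then
    -- yields `C`.
    have h2 : ∀ x, hjExpr H (fun z : M × ℝ => φ z.1) x 0 (φ x) =
        H x (mvfderiv (𝓡 n) φ x) (φ x) := fun x => by simp [hjExpr]
    refine continuous_iff_continuousAt.2 fun x => ?_
    have h3 := continuousAt_hjExpr hH (isC1At_space hφ (x, 0)) (φ x)
    have h4 : ContinuousAt (fun y : M => ((y, (0 : ℝ)), φ y)) x := by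
      have := hφ.continuous
      fun_prop
    have h5 := ContinuousAt.comp (f := fun y : M => ((y, (0 : ℝ)), φ y)) (x := x) h3 h4
    exact h5.congr (Eventually.of_forall h2)
  obtain ⟨C, hC⟩ := isCompact_univ.exists_bound_of_continuousOn h1.continuousOn
  exact ⟨max C 0, L, hL0, le_max_right _ _, hφ, hL,
    fun x => (hC x (mem_univ x)).trans (le_max_left _ _)⟩

variable [RiemannianBundle (fun x : M => TangentSpace (𝓡 n) x)]
  [IsContinuousRiemannianBundle (Model n) (fun x : M => TangentSpace (𝓡 n) x)]
  [IsRiemannianManifold (𝓡 n) M]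

theorem BarrierData.exists_lipschitzOnWith_perronSup (hB : BarrierData H φ C L)
    (hH : JointlyContinuous H) (hc : Coercive H) (S : ℝ) :
    ∃ K : ℝ≥0, LipschitzOnWith K (perronSup H φ C L) (cylinder M (S : EReal)) := by
  set u := perronSup H φ C L with hu
  obtain ⟨hsub, husc⟩ := hB.isPerronSubsolution_perronSup hH
  obtain ⟨R₀, hR₀⟩ := isCompact_univ.exists_bound_of_continuousOn hB.smooth.continuous.continuousOn
  have hC := fun (x : M) (s t : ℝ) (hs : 0 ≤ s) (hsS : s < S) (ht : 0 ≤ t) (htS : t < S) =>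
    hB.abs_perronSup_sub_le x hs hsS.le ht htS.le
  obtain ⟨K, hK, hlip⟩ := exists_abs_sub_le_mul_dist hc hsub husc
    (S := S) (R := R₀ + barrierTime C L S) (C := C * Real.exp (L * S)) (by
      intro x t ht htS
      have h1 := hB.lower_le_perronSup (z := (x, t)) ht.le
      have h2 := hB.perronSup_le_upper (z := (x, t)) ht.le
      have h3 := abs_le.1 (hR₀ x (mem_univ x))
      have h4 := barrierTime_mono hB.C_nonneg hB.L_pos htS.le
      simp only [lowerBarrier, upperBarrier] at h1 h2
      rw [abs_le]
      constructor <;> linarith [h3.1, h3.2])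
    (fun x s t hs hsS ht htS => hC x s t hs.le hsS ht.le htS)
  have hlip0 : ∀ t, 0 ≤ t → t < S → ∀ x y, |u (x, t) - u (y, t)| ≤ K * dist x y := by
    intro t ht htS x y
    rcases ht.eq_or_lt with rfl | ht
    -- The gradient argument covers positive times only; the time-Lipschitz bound carries its
    -- constant to time `0`.
    · have hlim : ∀ x, Tendsto (fun s => u (x, s)) (𝓝[>] 0) (𝓝 (u (x, 0))) := by
        intro x
        rw [tendsto_iff_norm_sub_tendsto_zero]
        have h1 : Tendsto (fun s : ℝ => C * Real.exp (L * S) * |s - 0|) (𝓝[>] 0) (𝓝 0) := by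
          have : Continuous (fun s : ℝ => C * Real.exp (L * S) * |s - 0|) := by fun_prop
          have h2 := this.tendsto 0
          simp only [sub_self, abs_zero, mul_zero] at h2
          exact h2.mono_left nhdsWithin_le_nhds
        refine squeeze_zero' (Eventually.of_forall fun _ => norm_nonneg _) ?_ h1
        filter_upwards [self_mem_nhdsWithin, nhdsWithin_le_nhds (eventually_lt_nhds htS)]
          with s hs hsS
        exact hC x s 0 (le_of_lt hs) hsS le_rfl htS
      refine le_of_tendsto ((hlim x).sub (hlim y)).abs ?_
      filter_upwards [self_mem_nhdsWithin, nhdsWithin_le_nhds (eventually_lt_nhds htS)]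
        with s hs hsS
      exact hlip s hs hsS x y
    · exact hlip t ht htS x y
  have hC0 : 0 ≤ C * Real.exp (L * S) := mul_nonneg hB.C_nonneg (Real.exp_nonneg _)
  refine ⟨Real.toNNReal (K + C * Real.exp (L * S)), LipschitzOnWith.of_dist_le_mul ?_⟩
  rintro ⟨x, s⟩ ⟨hs, hsS⟩ ⟨y, t⟩ ⟨ht, htS⟩
  have h1 := hlip0 s hs (EReal.coe_lt_coe_iff.1 hsS) x y
  have h2 := hC y s t hs (EReal.coe_lt_coe_iff.1 hsS) ht (EReal.coe_lt_coe_iff.1 htS)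
  have h3 : dist x y ≤ dist (x, s) (y, t) := le_max_left _ _
  have h4 : |s - t| ≤ dist (x, s) (y, t) := by
    rw [← Real.dist_eq]; exact le_max_right _ _
  rw [Real.dist_eq]
  calc |u (x, s) - u (y, t)| ≤ |u (x, s) - u (y, s)| + |u (y, s) - u (y, t)| :=
        abs_sub_le _ _ _
    _ ≤ K * dist x y + C * Real.exp (L * S) * |s - t| := add_le_add h1 h2
    _ ≤ K * dist (x, s) (y, t) + C * Real.exp (L * S) * dist (x, s) (y, t) := by gcongr
    _ = _ := by rw [Real.coe_toNNReal _ (add_nonneg hK hC0)]; ring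

/-- Where the supremum meets the upper barrier it inherits the test from that supersolution.
Strictly below there is room for a bump, which maximality forbids. -/
theorem BarrierData.supersolutionAt_perronSup (hB : BarrierData H φ C L)
    (hH : JointlyContinuous H) (hc : Coercive H) {z₀ : M × ℝ} (hz₀ : 0 < z₀.2) :
    SupersolutionAt H (perronSup H φ C L) z₀ := by
  obtain ⟨hsub, husc⟩ := hB.isPerronSubsolution_perronSup hH
  have hcont : ∀ z : M × ℝ, 0 < z.2 → ContinuousAt (perronSup H φ C L) z := by
    intro z hz
    obtain ⟨K, hK⟩ := hB.exists_lipschitzOnWith_perronSup hH hc (z.2 + 1)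
    refine hK.continuousOn.continuousAt ?_
    filter_upwards [continuous_snd.continuousAt.eventually (lt_mem_nhds hz),
      continuous_snd.continuousAt.eventually (gt_mem_nhds (show z.2 < z.2 + 1 by linarith))]
      with y hy hy'
    exact ⟨hy.le, EReal.coe_lt_coe_iff.2 hy'⟩
  rcases (hB.perronSup_le_upper hz₀.le).eq_or_lt with heq | hlt
  · refine (hB.supersolutionAt_upper hz₀.le).of_ge ?_ heq.symm
    filter_upwards [continuous_snd.continuousAt.eventually (lt_mem_nhds hz₀)] with y hy
    exact hB.perronSup_le_upper hy.le
  · by_contra hnot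
    obtain ⟨w, hw1, hw2, hw3, hw4⟩ := exists_larger_subsolution hH hz₀ hsub hcont
      hB.continuous_upper.continuousAt hlt hnot
    have hw : IsPerronSubsolution H φ C L w := ⟨hw1, hw2, fun z hz => by
      rcases hw4 z with h | h
      · rw [h]; exact hB.perronSup_le_upper hz
      · exact h.2⟩
    exact absurd (hw.le_perronSup hz₀.le) (not_le.2 hw3)

end Existence

/-! ### Comparison by doubling of variables -/

section SeparatedTests

variable {n : ℕ} {M : Type*} [MetricSpace M] [ChartedSpace (Model n) M]
  [IsManifold (𝓡 n) 1 M]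

theorem hasFDerivAt_norm_sub_sq (a ξ : Model n) :
    HasFDerivAt (fun ζ : Model n => ‖ζ - a‖ ^ 2) ((2 : ℝ) • innerSL ℝ (ξ - a)) ξ := by
  have h := ((hasFDerivAt_id ξ).sub_const a).norm_sq
  convert! h using 1
  ext v
  simp [two_smul]

theorem hasFDerivAt_norm_sub_sq' (a ξ : Model n) :
    HasFDerivAt (fun ζ : Model n => ‖a - ζ‖ ^ 2) (-((2 : ℝ) • innerSL ℝ (a - ξ))) ξ := by
  have h := hasFDerivAt_norm_sub_sq a ξ
  simp only [norm_sub_rev _ a] at h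
  convert! h using 1
  rw [← neg_sub a ξ, map_neg, smul_neg]

/-- Differentials of test functions with separated variables in a chart. -/
theorem chart_separated {c x : M} {t : ℝ} (hx : x ∈ (chartAt (Model n) c).source)
    {h : Model n → ℝ} {h' : Model n →L[ℝ] ℝ} (hh : ContDiff ℝ 1 h)
    (hh' : HasFDerivAt h h' (extChartAt (𝓡 n) c x)) {f : ℝ → ℝ} {f' : ℝ}
    (hf : ContDiffAt ℝ 1 f t) (hf' : HasDerivAt f f' t) :
    IsC1At n (fun z : M × ℝ => h (extChartAt (𝓡 n) c z.1) + f z.2) (x, t) ∧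
    deriv (fun s => h (extChartAt (𝓡 n) c x) + f s) t = f' ∧
    mvfderiv (𝓡 n) (fun y => h (extChartAt (𝓡 n) c y) + f t) x = chartCovector c x h' := by
  set g : Model n × ℝ → ℝ := fun z => h z.1 + f z.2 with hg
  have hgC : ContDiffAt ℝ 1 g (extChartAt (𝓡 n) c x, t) :=
    (hh.comp contDiff_fst).contDiffAt.add (hf.comp _ contDiffAt_snd)
  refine ⟨contMDiffAt_comp_chart hx hgC, (hf'.const_add _).deriv, ?_⟩
  rw [mvfderiv_eq_of_chart c x t (fun z : M × ℝ => h (extChartAt (𝓡 n) c z.1) + f z.2) g hx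
    (hgC.differentiableAt one_ne_zero) (Eventually.of_forall fun _ => rfl)]
  congr 1
  have h1 : HasFDerivAt (fun v : Model n => g (v, t))
      ((fderiv ℝ g (extChartAt (𝓡 n) c x, t)).comp (ContinuousLinearMap.inl ℝ (Model n) ℝ))
      (extChartAt (𝓡 n) c x) :=
    (hgC.differentiableAt one_ne_zero).hasFDerivAt.comp (f := fun v => (v, t)) _
      (hasFDerivAt_prodMk_left _ _)
  exact h1.unique (hh'.add_const (f t))

end SeparatedTests

section Comparison

variable {n : ℕ} {M : Type*} [MetricSpace M] [ChartedSpace (Model n) M]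
  [IsManifold (𝓡 n) 1 M] [RiemannianBundle (fun x : M => TangentSpace (𝓡 n) x)]
  [IsContinuousRiemannianBundle (Model n) (fun x : M => TangentSpace (𝓡 n) x)]

/-- The maximum principle for the difference of a subsolution and a supersolution, by doubling of
variables in a chart. -/
theorem deriv_le_of_sub_super {H : Hamiltonian n M} (hH : JointlyContinuous H) (hc : Coercive H)
    {L : ℝ} (hL : ∀ (x : M) (p : CotangentSpace n x) (u v : ℝ), |H x p u - H x p v| ≤ L * |u - v|)
    {u v : M × ℝ → ℝ} {g : ℝ → ℝ} {x₀ : M} {t₀ C : ℝ} (hg : ContDiffAt ℝ 1 g t₀)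
    (hu : ∀ᶠ z in 𝓝 (x₀, t₀), SubsolutionAt H u z)
    (hv : ∀ᶠ z in 𝓝 (x₀, t₀), SupersolutionAt H v z)
    (huc : ∀ᶠ z in 𝓝 (x₀, t₀), ContinuousAt u z)
    (hvc : ∀ᶠ z in 𝓝 (x₀, t₀), ContinuousAt v z)
    (htime : ∀ᶠ z in 𝓝 (x₀, t₀), ∀ᶠ s in 𝓝 z.2, z.2 < s →
      -C * (s - z.2) ≤ u (z.1, s) - u z)
    (hle : ∀ᶠ z in 𝓝 (x₀, t₀), u z - v z ≤ g z.2)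
    (heq : u (x₀, t₀) - v (x₀, t₀) = g t₀) :
    deriv g t₀ ≤ L * |u (x₀, t₀) - v (x₀, t₀)| := by
  set e := extChartAt (𝓡 n) x₀ with he
  set ξ₀ := e x₀ with hξ₀
  have hx₀ : e.symm ξ₀ = x₀ := extChartAt_to_inv x₀
  obtain ⟨D, hD, hcov⟩ := eventually_norm_le_norm_chartCovector (n := n) x₀
  obtain ⟨K, hK, hgrad⟩ := hc.exists_norm_mvfderiv_le (|u (x₀, t₀)| + 1) C
  have hbd : ∀ᶠ z in 𝓝 (x₀, t₀), |u z| ≤ |u (x₀, t₀)| + 1 :=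
    (huc.self_of_nhds.abs.eventually (gt_mem_nhds (by linarith))).mono fun z hz => le_of_lt hz
  have hcov' : ∀ᶠ z : M × ℝ in 𝓝 (x₀, t₀), ∀ p : Model n →L[ℝ] ℝ,
      ‖p‖ ≤ D * ‖(chartCovector x₀ z.1 p : CotangentSpace n z.1)‖ :=
    (continuous_fst.tendsto (x₀, t₀)).eventually hcov
  have hg' : ∀ᶠ z : M × ℝ in 𝓝 (x₀, t₀), ContDiffAt ℝ 1 g z.2 :=
    (continuous_snd.tendsto (x₀, t₀)).eventually (hg.eventually (by simp))
  have hgood := (((hu.and hv).and (huc.and hvc)).and (htime.and hle)).and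
    ((hbd.and hcov').and hg')
  have hsymm : ∀ ξ ∈ e.target, ∀ t : ℝ,
      ContinuousAt (fun z : Model n × ℝ => (e.symm z.1, z.2)) (ξ, t) := by
    intro ξ hξ t
    refine ContinuousAt.prodMk ?_ (by fun_prop)
    exact (continuousAt_extChartAt_symm'' (I := 𝓡 n) hξ).comp
      (f := fun z : Model n × ℝ => z.1) (x := (ξ, t)) continuousAt_fst
  have hgood' : ∀ᶠ X : Model n × ℝ in 𝓝 (ξ₀, t₀), X.1 ∈ e.target ∧
      ((((SubsolutionAt H u (e.symm X.1, X.2)) ∧ SupersolutionAt H v (e.symm X.1, X.2)) ∧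
        (ContinuousAt u (e.symm X.1, X.2) ∧ ContinuousAt v (e.symm X.1, X.2))) ∧
        ((∀ᶠ s in 𝓝 X.2, X.2 < s →
          -C * (s - X.2) ≤ u (e.symm X.1, s) - u (e.symm X.1, X.2)) ∧
          u (e.symm X.1, X.2) - v (e.symm X.1, X.2) ≤ g X.2)) ∧
      ((|u (e.symm X.1, X.2)| ≤ |u (x₀, t₀)| + 1 ∧ ∀ p : Model n →L[ℝ] ℝ,
        ‖p‖ ≤ D * ‖(chartCovector x₀ (e.symm X.1) p : CotangentSpace n (e.symm X.1))‖) ∧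
        ContDiffAt ℝ 1 g X.2) := by
    refine Eventually.and ?_ ?_
    · exact (continuous_fst.tendsto (ξ₀, t₀)).eventually
        ((isOpen_extChartAt_target x₀).mem_nhds (mem_extChartAt_target x₀))
    · have h1 := (hsymm ξ₀ (mem_extChartAt_target x₀) t₀).tendsto
      simp only [hx₀] at h1
      exact h1.eventually hgood
  obtain ⟨r, hr, hN⟩ := Metric.nhds_basis_closedBall.mem_iff.1 hgood'
  set N := Metric.closedBall ((ξ₀, t₀) : Model n × ℝ) r with hNdef
  have hNc : IsCompact N := isCompact_closedBall _ _
  set U : Model n × ℝ → ℝ := fun X => u (e.symm X.1, X.2) with hU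
  set V : Model n × ℝ → ℝ := fun X => v (e.symm X.1, X.2) with hV
  have hUc : ∀ X ∈ N, ContinuousAt U X := fun X hX =>
    ContinuousAt.comp (g := u) (f := fun z : Model n × ℝ => (e.symm z.1, z.2))
      (hN hX).2.1.1.2.1 (hsymm X.1 (hN hX).1 X.2)
  have hVc : ∀ X ∈ N, ContinuousAt V X := fun X hX =>
    ContinuousAt.comp (g := v) (f := fun z : Model n × ℝ => (e.symm z.1, z.2))
      (hN hX).2.1.1.2.2 (hsymm X.1 (hN hX).1 X.2)
  have hgc : ∀ X ∈ N, ContinuousAt (fun X : Model n × ℝ => g X.2) X := fun X hX =>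
    ((hN hX).2.2.2.continuousAt).comp (f := fun X : Model n × ℝ => X.2) continuousAt_snd
  have hX₀ : ((ξ₀, t₀) : Model n × ℝ) ∈ N := Metric.mem_closedBall_self hr.le
  -- `g`, like `loc` below, involves only the variable of `u`, so the test for `v` contains nothing
  -- but the penalty.
  set Θ : (Model n × ℝ) × (Model n × ℝ) → ℝ := fun Z => U Z.1 - V Z.2 - g Z.1.2 with hΘ
  have hΘc : ∀ Z ∈ N ×ˢ N, ContinuousAt Θ Z := by
    rintro ⟨X, Y⟩ ⟨hX, hY⟩
    have h1 : ContinuousAt (fun Z : (Model n × ℝ) × (Model n × ℝ) => U Z.1) (X, Y) :=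
      ContinuousAt.comp (g := U) (f := Prod.fst) (hUc X hX) continuousAt_fst
    have h2 : ContinuousAt (fun Z : (Model n × ℝ) × (Model n × ℝ) => V Z.2) (X, Y) :=
      ContinuousAt.comp (g := V) (f := Prod.snd) (hVc Y hY) continuousAt_snd
    have h3 : ContinuousAt (fun Z : (Model n × ℝ) × (Model n × ℝ) => g Z.1.2) (X, Y) :=
      ContinuousAt.comp (g := fun X : Model n × ℝ => g X.2) (f := Prod.fst) (hgc X hX)
        continuousAt_fst
    exact (h1.sub h2).sub h3
  obtain ⟨B, hB⟩ := (hNc.prod hNc).exists_bound_of_continuousOn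
    (fun Z hZ => (hΘc Z hZ).continuousWithinAt)
  set pen : (Model n × ℝ) × (Model n × ℝ) → ℝ := fun Z =>
    ‖Z.1.1 - Z.2.1‖ ^ 2 + (Z.1.2 - Z.2.2) ^ 2 with hpen
  -- Makes the contact at `(ξ₀, t₀)` strict, so the maximum points converge to it.
  set loc : (Model n × ℝ) × (Model n × ℝ) → ℝ := fun Z =>
    ‖Z.1.1 - ξ₀‖ ^ 2 + (Z.1.2 - t₀) ^ 2 with hloc
  have hpenc : Continuous pen := by simp only [hpen]; fun_prop
  have hlocc : Continuous loc := by simp only [hloc]; fun_prop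
  have hmaxk : ∀ k : ℕ, ∃ Z ∈ N ×ˢ N, IsMaxOn (fun Z => Θ Z - loc Z - k * pen Z) (N ×ˢ N) Z := by
    intro k
    refine (hNc.prod hNc).exists_isMaxOn ⟨((ξ₀, t₀), (ξ₀, t₀)), hX₀, hX₀⟩ fun Z hZ => ?_
    exact (((hΘc Z hZ).sub hlocc.continuousAt).sub
      (continuousAt_const.mul hpenc.continuousAt)).continuousWithinAt
  choose Z hZN hZmax using hmaxk
  have hΘ0 : Θ ((ξ₀, t₀), (ξ₀, t₀)) = 0 := by
    simp only [hΘ, hU, hV, hx₀]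
    linarith
  have hZ0 : ∀ k, loc (Z k) + k * pen (Z k) ≤ Θ (Z k) := by
    intro k
    have h1 := hZmax k (show (((ξ₀, t₀), (ξ₀, t₀)) : (Model n × ℝ) × (Model n × ℝ)) ∈ N ×ˢ N from
      ⟨hX₀, hX₀⟩)
    simp only [mem_ofPred_eq, hΘ0, hloc, hpen, sub_self, norm_zero] at h1
    simp only [hloc, hpen]
    norm_num at h1
    linarith
  -- Limits along a free ultrafilter replace successive extractions of subsequences.
  let 𝒰 : Ultrafilter ℕ := hyperfilter ℕ
  have h𝒰 : (𝒰 : Filter ℕ) ≤ atTop := Nat.hyperfilter_le_atTop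
  obtain ⟨Z', hZ'N, hZ'⟩ := (hNc.prod hNc).ultrafilter_le_nhds (𝒰.map Z) (by
    rw [le_principal_iff]
    change ∀ᶠ k in (𝒰 : Filter ℕ), Z k ∈ N ×ˢ N
    exact Eventually.of_forall hZN)
  have hlim : Tendsto Z 𝒰 (𝓝 Z') := hZ'
  have hpen0 : pen Z' ≤ 0 := by
    have h1 : Tendsto (fun k : ℕ => B / (k : ℝ)) 𝒰 (𝓝 0) :=
      (tendsto_const_div_atTop_nhds_zero_nat B).mono_left h𝒰
    refine le_of_tendsto_of_tendsto ((hpenc.tendsto Z').comp hlim) h1 ?_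
    filter_upwards [h𝒰 (eventually_gt_atTop 0)] with k hk
    have hk' : (0 : ℝ) < k := by exact_mod_cast hk
    simp only [Function.comp]
    rw [le_div_iff₀ hk']
    have h2 := hZ0 k
    have h3 := (abs_le.1 (hB _ (hZN k))).2
    have h4 : 0 ≤ loc (Z k) := by simp only [hloc]; positivity
    linarith
  have hZdiag : Z'.1 = Z'.2 := by
    have h1 : ‖Z'.1.1 - Z'.2.1‖ ^ 2 = 0 := by
      simp only [hpen] at hpen0
      nlinarith [sq_nonneg ‖Z'.1.1 - Z'.2.1‖, sq_nonneg (Z'.1.2 - Z'.2.2)]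
    have h2 : (Z'.1.2 - Z'.2.2) ^ 2 = 0 := by
      simp only [hpen] at hpen0
      nlinarith [sq_nonneg ‖Z'.1.1 - Z'.2.1‖, sq_nonneg (Z'.1.2 - Z'.2.2)]
    exact Prod.ext (sub_eq_zero.1 (norm_eq_zero.1 (pow_eq_zero_iff two_ne_zero |>.1 h1)))
      (sub_eq_zero.1 (pow_eq_zero_iff two_ne_zero |>.1 h2))
  have hloc0 : loc Z' ≤ 0 := by
    have h1 : loc Z' ≤ Θ Z' := by
      refine le_of_tendsto_of_tendsto ((hlocc.tendsto Z').comp hlim)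
        ((hΘc Z' hZ'N).tendsto.comp hlim) (Eventually.of_forall fun k => ?_)
      have h2 := hZ0 k
      have h3 : 0 ≤ (k : ℝ) * pen (Z k) := by simp only [hpen]; positivity
      simp only [Function.comp]
      linarith
    have h2 := (hN hZ'N.1).2.1.2.2
    have h3 : Θ Z' = U Z'.1 - V Z'.1 - g Z'.1.2 := by simp only [hΘ, ← hZdiag]
    rw [h3] at h1
    simp only [hU, hV] at h1
    linarith
  have hZ'1 : Z'.1 = (ξ₀, t₀) := by
    have h1 : ‖Z'.1.1 - ξ₀‖ ^ 2 = 0 := by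
      simp only [hloc] at hloc0
      nlinarith [sq_nonneg ‖Z'.1.1 - ξ₀‖, sq_nonneg (Z'.1.2 - t₀)]
    have h2 : (Z'.1.2 - t₀) ^ 2 = 0 := by
      simp only [hloc] at hloc0
      nlinarith [sq_nonneg ‖Z'.1.1 - ξ₀‖, sq_nonneg (Z'.1.2 - t₀)]
    exact Prod.ext (sub_eq_zero.1 (norm_eq_zero.1 (pow_eq_zero_iff two_ne_zero |>.1 h1)))
      (sub_eq_zero.1 (pow_eq_zero_iff two_ne_zero |>.1 h2))
  have hXlim : Tendsto (fun k => (Z k).1) 𝒰 (𝓝 (ξ₀, t₀)) := by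
    rw [← hZ'1]; exact (continuous_fst.tendsto Z').comp hlim
  have hYlim : Tendsto (fun k => (Z k).2) 𝒰 (𝓝 (ξ₀, t₀)) := by
    rw [← hZ'1, hZdiag]; exact (continuous_snd.tendsto Z').comp hlim
  set q : ℕ → Model n →L[ℝ] ℝ := fun k =>
    (k : ℝ) • (2 : ℝ) • innerSL ℝ ((Z k).1.1 - (Z k).2.1) with hq
  -- `p k` and `q k` are the momenta tested on `u` and `v`; they differ by the gradient of `loc`,
  -- which tends to zero.
  set p : ℕ → Model n →L[ℝ] ℝ := fun k =>
    (2 : ℝ) • innerSL ℝ ((Z k).1.1 - ξ₀) + q k with hp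
  have hball : Metric.ball ((ξ₀, t₀) : Model n × ℝ) r ∈ 𝓝 (ξ₀, t₀) := Metric.ball_mem_nhds _ hr
  have hloclift : ∀ X ∈ Metric.ball ((ξ₀, t₀) : Model n × ℝ) r,
      ∀ᶠ z : M × ℝ in 𝓝 (e.symm X.1, X.2), (e z.1, z.2) ∈ N ∧ e.symm (e z.1) = z.1 := by
    intro X hX
    have hXN := hN (Metric.ball_subset_closedBall hX)
    have hs : e.symm X.1 ∈ (chartAt (Model n) x₀).source := by
      have := e.map_target hXN.1
      rwa [he, extChartAt_source] at this
    refine Eventually.and ?_ ?_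
    · refine eventually_chart_of_eventually_model (P := fun X => X ∈ N) hs ?_
      have h1 : extChartAt (𝓡 n) x₀ (e.symm X.1) = X.1 := e.right_inv hXN.1
      rw [h1]
      exact mem_of_superset (Metric.isOpen_ball.mem_nhds hX) Metric.ball_subset_closedBall
    · filter_upwards [continuous_fst.continuousAt.eventually
        ((chartAt (Model n) x₀).open_source.mem_nhds hs)] with z hz
      exact e.left_inv (by rwa [he, extChartAt_source])
  have hsrc : ∀ X ∈ N, e.symm X.1 ∈ (chartAt (Model n) x₀).source := by
    intro X hX
    have := e.map_target (hN hX).1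
    rwa [he, extChartAt_source] at this
  -- Subtracting the two viscosity inequalities cancels the time derivatives `2k(s - s')` of the
  -- penalty. The bound on `p k` is the coercive gradient estimate for `u`.
  have htests : ∀ᶠ k in (𝒰 : Filter ℕ), ‖p k‖ ≤ D * K ∧
      deriv g (Z k).1.2 + 2 * ((Z k).1.2 - t₀) +
        H (e.symm (Z k).1.1) (chartCovector x₀ (e.symm (Z k).1.1) (p k)) (U (Z k).1) -
        H (e.symm (Z k).2.1) (chartCovector x₀ (e.symm (Z k).2.1) (q k)) (V (Z k).2) ≤ 0 := by
    filter_upwards [hXlim hball, hYlim hball] with k hXk hYk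
    have hmax := hZmax k
    obtain ⟨hXN, hYN⟩ := hZN k
    set X := (Z k).1 with hX
    set Y := (Z k).2 with hY
    have hZk : Z k = (X, Y) := rfl
    have hXg := hN hXN
    have hYg := hN hYN
    have hXe : e (e.symm X.1) = X.1 := e.right_inv hXg.1
    have hYe : e (e.symm Y.1) = Y.1 := e.right_inv hYg.1
    -- the test from above
    have h1C : ContDiff ℝ 1 (fun ξ : Model n => ‖ξ - ξ₀‖ ^ 2 + k * ‖ξ - Y.1‖ ^ 2) :=
      ((contDiff_id.sub contDiff_const).norm_sq ℝ).add
        (contDiff_const.mul ((contDiff_id.sub contDiff_const).norm_sq ℝ))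
    have h1D : HasFDerivAt (fun ξ : Model n => ‖ξ - ξ₀‖ ^ 2 + k * ‖ξ - Y.1‖ ^ 2) (p k)
        (extChartAt (𝓡 n) x₀ (e.symm X.1)) := by
      have : extChartAt (𝓡 n) x₀ (e.symm X.1) = X.1 := hXe
      rw [this]
      exact (hasFDerivAt_norm_sub_sq ξ₀ X.1).add ((hasFDerivAt_norm_sub_sq Y.1 X.1).const_mul (k : ℝ))
    have h1f : ContDiffAt ℝ 1 (fun t : ℝ => g t + (t - t₀) ^ 2 + k * (t - Y.2) ^ 2) X.2 :=
      (hXg.2.2.2.add (by fun_prop)).add (by fun_prop)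
    have h1f' : HasDerivAt (fun t : ℝ => g t + (t - t₀) ^ 2 + k * (t - Y.2) ^ 2)
        (deriv g X.2 + 2 * (X.2 - t₀) + k * (2 * (X.2 - Y.2))) X.2 := by
      have h2 := (hXg.2.2.2.differentiableAt one_ne_zero).hasDerivAt
      have h3 : ∀ a : ℝ, HasDerivAt (fun t : ℝ => (t - a) ^ 2) (2 * (X.2 - a)) X.2 := fun a => by
        simpa using ((hasDerivAt_id X.2).sub_const a).fun_pow 2
      exact (h2.add (h3 t₀)).add ((h3 Y.2).const_mul (k : ℝ))
    obtain ⟨t1, t2, t3⟩ := chart_separated (hsrc X hXN) h1C h1D h1f h1f'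
    have hmax1 : IsLocalMax (fun z : M × ℝ => u z -
        ((‖e z.1 - ξ₀‖ ^ 2 + k * ‖e z.1 - Y.1‖ ^ 2) +
          (g z.2 + (z.2 - t₀) ^ 2 + k * (z.2 - Y.2) ^ 2))) (e.symm X.1, X.2) := by
      filter_upwards [hloclift X hXk] with z hz
      have h2 := hmax (show ((e z.1, z.2), Y) ∈ N ×ˢ N from ⟨hz.1, hYN⟩)
      simp only [mem_ofPred_eq, hZk, hΘ, hloc, hpen, hU, hz.2] at h2
      simp only [hXe]
      linarith
    have s1 := hXg.2.1.1.1.1 _ t1 hmax1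
    have s2 := hgrad u _ _ _ hXg.2.1.1.1.1 hXg.2.2.1.1 hXg.2.1.2.1 t1 hmax1
    rw [t3] at s2
    simp only [hjExpr, t2, t3] at s1
    -- the test from below
    have h2C : ContDiff ℝ 1 (fun ξ : Model n => -(k * ‖X.1 - ξ‖ ^ 2)) :=
      (contDiff_const.mul ((contDiff_const.sub contDiff_id).norm_sq ℝ)).neg
    have h2D : HasFDerivAt (fun ξ : Model n => -(k * ‖X.1 - ξ‖ ^ 2)) (q k)
        (extChartAt (𝓡 n) x₀ (e.symm Y.1)) := by
      have : extChartAt (𝓡 n) x₀ (e.symm Y.1) = Y.1 := hYe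
      rw [this]
      have h3 := ((hasFDerivAt_norm_sub_sq' X.1 Y.1).const_mul (k : ℝ)).neg
      convert! h3 using 1
      simp only [hq, smul_neg, neg_neg]
      rfl
    have h2f : ContDiffAt ℝ 1 (fun t : ℝ => -(k * (X.2 - t) ^ 2)) Y.2 := by fun_prop
    have h2f' : HasDerivAt (fun t : ℝ => -(k * (X.2 - t) ^ 2)) (k * (2 * (X.2 - Y.2))) Y.2 := by
      have h3 := ((((hasDerivAt_id Y.2).const_sub X.2).pow 2).const_mul (k : ℝ)).neg
      convert! h3 using 1
      simp
    obtain ⟨w1, w2, w3⟩ := chart_separated (hsrc Y hYN) h2C h2D h2f h2f'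
    have hmin1 : IsLocalMin (fun z : M × ℝ => v z -
        (-(k * ‖X.1 - e z.1‖ ^ 2) + -(k * (X.2 - z.2) ^ 2))) (e.symm Y.1, Y.2) := by
      filter_upwards [hloclift Y hYk] with z hz
      have h2 := hmax (show (X, (e z.1, z.2)) ∈ N ×ˢ N from ⟨hXN, hz.1⟩)
      simp only [mem_ofPred_eq, hZk, hΘ, hloc, hpen, hV, hz.2] at h2
      simp only [hYe]
      linarith
    have s3 := hYg.2.1.1.1.2 _ w1 hmin1
    simp only [hjExpr, w2, w3] at s3
    refine ⟨(hXg.2.2.1.2 (p k)).trans (by gcongr), ?_⟩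
    simp only [hU, hV]
    linarith
  obtain ⟨p', -, hp'⟩ := (isCompact_closedBall (0 : Model n →L[ℝ] ℝ) (D * K)).ultrafilter_le_nhds
    (𝒰.map p) (by
      rw [le_principal_iff]
      change ∀ᶠ k in (𝒰 : Filter ℕ), p k ∈ Metric.closedBall 0 (D * K)
      filter_upwards [htests] with k hk
      rw [mem_closedBall_zero_iff]
      exact hk.1)
  have hplim : Tendsto p 𝒰 (𝓝 p') := hp'
  have hX1 : Tendsto (fun k => (Z k).1.1) 𝒰 (𝓝 ξ₀) := (continuous_fst.tendsto (ξ₀, t₀)).comp hXlim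
  have hX2 : Tendsto (fun k => (Z k).1.2) 𝒰 (𝓝 t₀) := (continuous_snd.tendsto (ξ₀, t₀)).comp hXlim
  have hY1 : Tendsto (fun k => (Z k).2.1) 𝒰 (𝓝 ξ₀) := (continuous_fst.tendsto (ξ₀, t₀)).comp hYlim
  have hqlim : Tendsto q 𝒰 (𝓝 p') := by
    have h1 : Tendsto (fun k => (2 : ℝ) • innerSL ℝ ((Z k).1.1 - ξ₀)) 𝒰
        (𝓝 ((2 : ℝ) • innerSL ℝ (ξ₀ - ξ₀))) := by
      have h2 : Continuous fun ξ : Model n => (2 : ℝ) • innerSL ℝ (ξ - ξ₀) := by fun_prop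
      exact (h2.tendsto ξ₀).comp hX1
    simp only [sub_self, map_zero, smul_zero] at h1
    have h3 := hplim.sub h1
    rw [sub_zero] at h3
    refine h3.congr fun k => ?_
    simp only [hp]
    abel
  have hsl : Tendsto e.symm (𝓝 ξ₀) (𝓝 x₀) := by
    have := (continuousAt_extChartAt_symm (I := 𝓡 n) x₀).tendsto
    rwa [extChartAt_to_inv] at this
  -- Both Hamiltonians tend to values at the same `x₀` and the same covector `p'`, leaving only a
  -- difference in the last argument.
  have hHlim : ∀ (Y : ℕ → Model n) (P : ℕ → Model n →L[ℝ] ℝ) (R : ℕ → ℝ) (R' : ℝ),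
      Tendsto Y 𝒰 (𝓝 ξ₀) → Tendsto P 𝒰 (𝓝 p') → Tendsto R 𝒰 (𝓝 R') →
      Tendsto (fun k => H (e.symm (Y k)) (chartCovector x₀ (e.symm (Y k)) (P k)) (R k)) 𝒰
        (𝓝 (H x₀ (chartCovector x₀ x₀ p') R')) := by
    intro Y P R R' h1 h2 h3
    have h4 : ContinuousAt (fun q : M × (Model n →L[ℝ] ℝ) × ℝ =>
        H q.1 (chartCovector x₀ q.1 q.2.1) q.2.2) (x₀, p', R') :=
      (continuousOn_hamiltonian_chartCovector hH x₀).continuousAt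
        (((chartAt (Model n) x₀).open_source.prod isOpen_univ).mem_nhds
          ⟨mem_chart_source _ _, mem_univ _⟩)
    exact h4.tendsto.comp ((hsl.comp h1).prodMk_nhds (h2.prodMk_nhds h3))
  have hUlim : Tendsto (fun k => U (Z k).1) 𝒰 (𝓝 (u (x₀, t₀))) := by
    have h1 : U (ξ₀, t₀) = u (x₀, t₀) := by simp only [hU, hx₀]
    rw [← h1]
    exact (hUc _ hX₀).tendsto.comp hXlim
  have hVlim : Tendsto (fun k => V (Z k).2) 𝒰 (𝓝 (v (x₀, t₀))) := by
    have h1 : V (ξ₀, t₀) = v (x₀, t₀) := by simp only [hV, hx₀]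
    rw [← h1]
    exact (hVc _ hX₀).tendsto.comp hYlim
  have hglim : Tendsto (fun k => deriv g (Z k).1.2) 𝒰 (𝓝 (deriv g t₀)) := by
    have h1 : ContinuousAt (deriv g) t₀ := by
      have h2 := (hg.fderiv_right (m := 0) (by simp)).continuousAt.clm_apply
        (continuousAt_const (y := (1 : ℝ)))
      simpa only [fderiv_apply_one_eq_deriv] using h2
    exact h1.tendsto.comp hX2
  have hfin := le_of_tendsto (((hglim.add ((hX2.sub_const t₀).const_mul 2)).add
    (hHlim _ _ _ _ hX1 hplim hUlim)).sub (hHlim _ _ _ _ hY1 hqlim hVlim))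
    (htests.mono fun k hk => hk.2)
  rw [sub_self, mul_zero, add_zero] at hfin
  have h1 := (abs_le.1 (hL x₀ (chartCovector x₀ x₀ p') (u (x₀, t₀)) (v (x₀, t₀)))).1
  linarith

/-- Comparison of time-Lipschitz subsolutions with continuous supersolutions. -/
theorem le_of_sub_super [CompactSpace M] {H : Hamiltonian n M} (hH : JointlyContinuous H)
    (hc : Coercive H) {L : ℝ} (hL0 : 0 < L)
    (hL : ∀ (x : M) (p : CotangentSpace n x) (u v : ℝ), |H x p u - H x p v| ≤ L * |u - v|)
    {u v : M × ℝ → ℝ} {S C : ℝ}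
    (hu : ∀ z : M × ℝ, 0 < z.2 → z.2 < S → SubsolutionAt H u z)
    (hv : ∀ z : M × ℝ, 0 < z.2 → z.2 < S → SupersolutionAt H v z)
    (huc : ContinuousOn u (cylinder M (S : EReal))) (hvc : ContinuousOn v (cylinder M (S : EReal)))
    (htime : ∀ (x : M) (s t : ℝ), 0 < s → s < t → t < S → -C * (t - s) ≤ u (x, t) - u (x, s))
    (h0 : ∀ x, u (x, 0) ≤ v (x, 0)) {z : M × ℝ} (hz : z ∈ cylinder M (S : EReal)) :
    u z ≤ v z := by
  have hcyl : ∀ y : M × ℝ, y ∈ cylinder M (S : EReal) ↔ 0 ≤ y.2 ∧ y.2 < S := fun y =>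
    and_congr_right fun _ => EReal.coe_lt_coe_iff
  by_contra hlt
  rw [not_le] at hlt
  obtain ⟨hz0, hzS⟩ := (hcyl z).1 hz
  obtain ⟨S', hzS', hS'⟩ := exists_between hzS
  -- The linear factor excludes a maximum at the final time `S'`. The exponential makes `g = δ / m`
  -- grow at a rate above `2 * L`, against the bound `L * g` from `deriv_le_of_sub_super`.
  set m : ℝ → ℝ := fun t => (S' - t) * Real.exp (-(2 * L * t)) with hm
  have hmc : Continuous m := by simp only [hm]; fun_prop
  set A : Set (M × ℝ) := univ ×ˢ Icc 0 S' with hA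
  have hAc : IsCompact A := isCompact_univ.prod isCompact_Icc
  have hAcyl : A ⊆ cylinder M (S : EReal) := fun y hy =>
    (hcyl y).2 ⟨hy.2.1, hy.2.2.trans_lt hS'⟩
  have hzA : z ∈ A := ⟨mem_univ _, hz0, hzS'.le⟩
  obtain ⟨⟨x₀, t₀⟩, hA₀, hmax⟩ := hAc.exists_isMaxOn ⟨z, hzA⟩
    (f := fun y : M × ℝ => (u y - v y) * m y.2)
    (((huc.mono hAcyl).sub (hvc.mono hAcyl)).mul (hmc.comp continuous_snd).continuousOn)
  obtain ⟨-, ht₀, ht₀S⟩ := hA₀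
  simp only at ht₀ ht₀S
  set δ := (u (x₀, t₀) - v (x₀, t₀)) * m t₀ with hδ
  have hδ0 : 0 < δ := by
    refine lt_of_lt_of_le ?_ (hmax hzA)
    exact mul_pos (sub_pos.2 hlt) (mul_pos (sub_pos.2 hzS') (Real.exp_pos _))
  have ht₀S' : t₀ < S' := by
    refine lt_of_le_of_ne ht₀S fun h => ?_
    rw [hδ, h] at hδ0
    simp [hm] at hδ0
  -- At time `0` the ordering of the initial data contradicts `δ > 0`.
  have ht₀0 : 0 < t₀ := by
    refine lt_of_le_of_ne ht₀ fun h => ?_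
    rw [hδ, ← h] at hδ0
    have h1 : 0 ≤ m 0 := by simp only [hm]; rw [← h] at ht₀S'; simp; exact ht₀S'.le
    nlinarith [h0 x₀]
  set g : ℝ → ℝ := fun t => δ * Real.exp (2 * L * t) / (S' - t) with hg
  have hmpos : ∀ t, t < S' → 0 < m t := fun t ht => mul_pos (sub_pos.2 ht) (Real.exp_pos _)
  have hgm : ∀ t, t < S' → g t = δ / m t := by
    intro t ht
    have h1 : S' - t ≠ 0 := (sub_pos.2 ht).ne'
    simp only [hg, hm, Real.exp_neg]
    field_simp
  have hne : S' - t₀ ≠ 0 := (sub_pos.2 ht₀S').ne'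
  have hgC : ContDiffAt ℝ 1 g t₀ := by
    refine ContDiffAt.div ?_ ?_ hne <;> fun_prop
  have hgd : deriv g t₀ = (2 * L + 1 / (S' - t₀)) * g t₀ := by
    have h1 : HasDerivAt (fun t : ℝ => 2 * L * t) (2 * L) t₀ := by
      simpa using (hasDerivAt_id t₀).const_mul (2 * L)
    have h2 : HasDerivAt (fun t : ℝ => S' - t) (-1) t₀ := by
      simpa using (hasDerivAt_id t₀).const_sub S'
    have h3 := ((h1.exp.const_mul δ).fun_div h2 hne).deriv
    rw [hg, h3]
    field_simp
    ring
  have hcylN : ∀ᶠ y : M × ℝ in 𝓝 (x₀, t₀), 0 < y.2 ∧ y.2 < S' :=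
    ((continuous_snd.tendsto (x₀, t₀)).eventually (lt_mem_nhds ht₀0)).and
      ((continuous_snd.tendsto (x₀, t₀)).eventually (gt_mem_nhds ht₀S'))
  have hnhds : ∀ y : M × ℝ, 0 < y.2 → y.2 < S' → cylinder M (S : EReal) ∈ 𝓝 y := by
    intro y hy hy'
    filter_upwards [(continuous_snd.tendsto y).eventually (lt_mem_nhds hy),
      (continuous_snd.tendsto y).eventually (gt_mem_nhds hy')] with a ha ha'
    exact (hcyl a).2 ⟨ha.le, ha'.trans hS'⟩
  have hgt₀ : u (x₀, t₀) - v (x₀, t₀) = g t₀ := by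
    rw [hgm t₀ ht₀S', hδ, mul_div_assoc, div_self (hmpos t₀ ht₀S').ne', mul_one]
  have hgpos : 0 < g t₀ := by rw [hgm t₀ ht₀S']; exact div_pos hδ0 (hmpos t₀ ht₀S')
  have key := deriv_le_of_sub_super hH hc hL (C := C) hgC
    (hcylN.mono fun y hy => hu y hy.1 (hy.2.trans hS'))
    (hcylN.mono fun y hy => hv y hy.1 (hy.2.trans hS'))
    (hcylN.mono fun y hy => huc.continuousAt (hnhds y hy.1 hy.2))
    (hcylN.mono fun y hy => hvc.continuousAt (hnhds y hy.1 hy.2))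
    (hcylN.mono fun y hy => by
      filter_upwards [eventually_lt_nhds (hy.2.trans hS')] with s hs hys
      exact htime y.1 y.2 s hy.1 hys hs)
    (hcylN.mono fun y hy => by
      rw [hgm y.2 hy.2, le_div_iff₀ (hmpos y.2 hy.2)]
      exact hmax (show y ∈ A from ⟨mem_univ _, hy.1.le, hy.2.le⟩))
    hgt₀
  rw [hgd, hgt₀, abs_of_pos hgpos] at key
  have h1 : 0 < 1 / (S' - t₀) := one_div_pos.2 (sub_pos.2 ht₀S')
  have h2 : 2 * L + 1 / (S' - t₀) ≤ L := le_of_mul_le_mul_right key hgpos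
  linarith

end Comparison

theorem IsLipschitzOnCylinder.continuousOn {M : Type*} [MetricSpace M] {T : EReal} (hT : 0 < T)
    {u : M × ℝ → ℝ} (hu : IsLipschitzOnCylinder T u) : ContinuousOn u (openCylinder M T) := by
  intro z hz
  obtain ⟨S, hS, hev⟩ := eventually_lt_real_of_lt hT z.2
  obtain ⟨K, hK⟩ := hu S hS
  have hzS : z.2 < S := hev.self_of_nhds hz.2
  refine (hK.continuousOn.continuousAt ?_).continuousWithinAt
  filter_upwards [(continuous_snd.tendsto z).eventually (lt_mem_nhds hz.1),
    (continuous_snd.tendsto z).eventually (gt_mem_nhds hzS)] with y h1 h2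
  exact ⟨h1.le, EReal.coe_lt_coe_iff.2 h2⟩

theorem IsLipschitzOnCylinder.isBounded_image {M : Type*} [MetricSpace M] [CompactSpace M]
    {T : EReal} {u : M × ℝ → ℝ} (hu : IsLipschitzOnCylinder T u) {S : ℝ} (hS : (S : EReal) ≤ T) :
    Bornology.IsBounded (u '' cylinder M (S : EReal)) := by
  obtain ⟨K, hK⟩ := hu S hS
  have hsub : cylinder M (S : EReal) ⊆ univ ×ˢ Icc (0 : ℝ) S := fun z hz =>
    mk_mem_prod (mem_univ z.1) ⟨hz.1, (EReal.coe_lt_coe_iff.1 hz.2).le⟩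
  have hbdd : Bornology.IsBounded (cylinder M (S : EReal)) :=
    (isCompact_univ.prod isCompact_Icc).isBounded.subset hsub
  obtain ⟨C, hC⟩ := Metric.isBounded_iff.1 hbdd
  refine Metric.isBounded_iff.2 ⟨K * C, ?_⟩
  rintro _ ⟨y, hy, rfl⟩ _ ⟨z, hz, rfl⟩
  exact (hK.dist_le_mul y hy z hz).trans (mul_le_mul_of_nonneg_left (hC hy hz) K.2)

/-! ### Uniqueness and conclusion -/

section Main

variable {n : ℕ} {M : Type*} [MetricSpace M] [CompactSpace M]
  [ChartedSpace (Model n) M] [IsManifold (𝓡 n) ∞ M]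
  [RiemannianBundle (fun x : M => TangentSpace (𝓡 n) x)]
  [IsContinuousRiemannianBundle (Model n) (fun x : M => TangentSpace (𝓡 n) x)]

/-- Comparison on a finite cylinder containing `z`, with the Lipschitz constant of `u` supplying the
time bound. Exchanging `u` and `v` gives uniqueness. -/
theorem IsCauchySolution.le {H : Hamiltonian n M} (hH : JointlyContinuous H)
    (hc : Coercive H) (hL : EquiLipschitz H) {T : EReal} (hT : 0 < T) {φ : M → ℝ}
    {u v : M × ℝ → ℝ} (hul : IsLipschitzOnCylinder T u) (hvl : IsLipschitzOnCylinder T v)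
    (hu : IsCauchySolution H T φ u) (hv : IsCauchySolution H T φ v) {z : M × ℝ}
    (hz : z ∈ cylinder M T) : u z ≤ v z := by
  obtain ⟨L, hL0, hL⟩ := hL
  obtain ⟨S, hS, hev⟩ := eventually_lt_real_of_lt hT z.2
  have hzS : z.2 < S := hev.self_of_nhds hz.2
  obtain ⟨Ku, hKu⟩ := hul S hS
  obtain ⟨Kv, hKv⟩ := hvl S hS
  have hopen : ∀ y : M × ℝ, 0 < y.2 → y.2 < S → y ∈ openCylinder M T := fun y h1 h2 =>
    ⟨h1, (EReal.coe_lt_coe_iff.2 h2).trans_le hS⟩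
  refine le_of_sub_super hH hc hL0 hL (S := S) (C := Ku)
    (fun y h1 h2 => hu.1.subsolutionAt hT (fun R hR => (hul.isBounded_image hR).bddAbove)
      (hopen y h1 h2))
    (fun y h1 h2 => hv.2.1.supersolutionAt hT (fun R hR => (hvl.isBounded_image hR).bddBelow)
      (hopen y h1 h2))
    hKu.continuousOn hKv.continuousOn ?_ (fun x => by rw [hu.2.2, hv.2.2])
    ⟨hz.1, EReal.coe_lt_coe_iff.2 hzS⟩
  intro x s t hs hst htS
  have h1 := hKu.dist_le_mul (x, t) ⟨(hs.trans hst).le, EReal.coe_lt_coe_iff.2 htS⟩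
    (x, s) ⟨hs.le, EReal.coe_lt_coe_iff.2 (hst.trans htS)⟩
  rw [Real.dist_eq, Prod.dist_eq, dist_self, Real.dist_eq, max_eq_right (abs_nonneg _),
    abs_of_pos (sub_pos.2 hst)] at h1
  linarith [(abs_le.1 h1).1]

end Main

end ContactHJ

open ContactHJ
theorem theoremA1 {n : ℕ} {M : Type*} [MetricSpace M] [CompactSpace M] [ConnectedSpace M]
    [ChartedSpace (Model n) M] [IsManifold (𝓡 n) ∞ M]
    [RiemannianBundle (fun x : M => TangentSpace (𝓡 n) x)]
    [IsContMDiffRiemannianBundle (𝓡 n) ∞ (Model n) (fun x : M => TangentSpace (𝓡 n) x)]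
    [IsRiemannianManifold (𝓡 n) M]
    (H : Hamiltonian n M) (hH1 : JointlyContinuous H) (hH2 : Coercive H)
    (hH3 : ConvexInMomentum H) (hH4 : EquiLipschitz H)
    (T : EReal) (hT : 0 < T) (φ : M → ℝ) (hφ : ContMDiff (𝓡 n) 𝓘(ℝ, ℝ) 1 φ) :
    ∃ u : M × ℝ → ℝ,
      (IsLipschitzOnCylinder T u ∧ IsCauchySolution H T φ u) ∧
        ∀ v : M × ℝ → ℝ, IsLipschitzOnCylinder T v → IsCauchySolution H T φ v →
          EqOn u v (cylinder M T) := by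
  have : IsContinuousRiemannianBundle (Model n) (fun x : M => TangentSpace (𝓡 n) x) := by
    obtain ⟨g, hg, hgi⟩ := IsContMDiffRiemannianBundle.exists_contMDiff (IB := 𝓡 n) (n := ∞)
      (F := Model n) (E := fun x : M => TangentSpace (𝓡 n) x)
    exact ⟨g, hg.continuous, hgi⟩
  obtain ⟨C, L, hB⟩ := exists_barrierData hH1 hH4 hφ
  -- The Perron supremum is built on all of `[0,∞)`, independently of `T`, and restricts to every
  -- cylinder.
  have hlip : IsLipschitzOnCylinder T (perronSup H φ C L) := fun S _ =>
    hB.exists_lipschitzOnWith_perronSup hH1 hH2 S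
  have hsol : IsCauchySolution H T φ (perronSup H φ C L) :=
    ⟨.of_subsolutionAt (hlip.continuousOn hT) fun z hz =>
        (hB.isPerronSubsolution_perronSup hH1).1 z hz.1,
      .of_supersolutionAt (hlip.continuousOn hT) fun z hz =>
        hB.supersolutionAt_perronSup hH1 hH2 hz.1,
      hB.perronSup_zero⟩
  exact ⟨_, ⟨hlip, hsol⟩, fun v hv hv' z hz =>
    le_antisymm (hsol.le hH1 hH2 hH4 hT hlip hv hv' hz) (hv'.le hH1 hH2 hH4 hT hv hlip hsol hz)⟩
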